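/- Consider the three-dimensional MHD system with unit viscosity and unit magnetic diffusivity, $$\partial_t u+(u\cdot\nabla)u+\nabla\pi=\Delta u+(b\cdot\nabla)b,\qquad \partial_t b+(u\cdot\nabla)b=\Delta b+(b\cdot\nabla)u,\qquad \nabla\cdot u=\nabla\cdot b=0,$$ for $u,b:\mathbb R^3\times(0,T)\to\mathbb R^3$ and $\pi:\mathbb R^3\times(0,T)\to\mathbb R$. Write $\nabla_h=(\partial_1,\partial_2,0)$, $\Delta_h=\partial_1^2+\partial_2^2$ and $\omega_3=\partial_1u_2-\partial_2u_1$. For $i,j\in\{1,2\}$ and $f\in L^2(\mathbb R^3)$ let $\partial_i\partial_j\Delta_h^{-1}f\in L^2(\mathbb R^3)$ be given by the Fourier multiplier $\xi_i\xi_j/(\xi_1^2+\xi_2^2)$, and let $\nabla_h^2\Delta_h^{-1}f=(\partial_i\partial_j\Delta_h^{-1}f)_{i,j\in\{1,2\}}$; $|\cdot|$ denotes the Euclidean norm of all entries. There is an absolute constant $c\ge 0$ such that for every $T$, every $C^\infty$ solution $(u,b,\pi)$ of the MHD system on $\mathbb R^3\times(0,T)$, and every time $t\in(0,T)$ at which $u(t),b(t)\in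 H^2(\mathbb R^3)$, both integrals below converge absolutely and, at time $t$, $$\int_{\mathbb R^3}\Big[(u\cdot\nabla)u\cdot\Delta_hu-(b\cdot\nabla)b\cdot\Delta_hu+(u\cdot\nabla)b\cdot\Delta_hb-(b\cdot\nabla)u\cdot\Delta_hb\Big]dx$$ $$\le c\int_{\mathbb R^3}\Big[|u_3|\big(|\nabla u||\nabla\nabla_hu|+|\nabla b||\nabla\nabla_hb|\big)+|b_3|\big(|\nabla u||\nabla\nabla_hb|+|\nabla b||\nabla\nabla_hu|\big)+|\nabla_hb|^2\,|\nabla_h^2\Delta_h^{-1}\omega_3|+|\nabla_h^2\Delta_h^{-1}u_3|\,|\nabla\nabla_hb|\,|\nabla_hb|\Big]dx.$$ -/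

import Mathlib

open MeasureTheory

noncomputable section

/-- Physical space `ℝ³`; the coordinates `x₁, x₂, x₃` carry the indices `0, 1, 2`. -/
abbrev R3 : Type := EuclideanSpace ℝ (Fin 3)

/-- The `j`-th component of a vector field. -/
def comp (v : R3 → R3) (j : Fin 3) : R3 → ℝ := fun x => v x j

/-- The partial derivative `∂ᵢ f`. -/
def pd (i : Fin 3) (f : R3 → ℝ) : R3 → ℝ :=
  fun x => fderiv ℝ f x (EuclideanSpace.single i 1)

/-- The Laplacian `Δ = ∂₁² + ∂₂² + ∂₃²`. -/
def lap (f : R3 → ℝ) : R3 → ℝ := fun x => ∑ i : Fin 3, pd i (pd i f) x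

/-- The horizontal Laplacian `Δ_h = ∂₁² + ∂₂²`. -/
def lapH (f : R3 → ℝ) : R3 → ℝ := fun x => pd 0 (pd 0 f) x + pd 1 (pd 1 f) x

/-- The `j`-th component of `(v · ∇) w`. -/
def advect (v w : R3 → R3) (j : Fin 3) : R3 → ℝ :=
  fun x => ∑ i : Fin 3, v x i * pd i (comp w j) x

/-- The divergence `∇ · v`. -/
def divergence (v : R3 → R3) : R3 → ℝ := fun x => ∑ i : Fin 3, pd i (comp v i) x

/-- The third component `∂₁v₂ - ∂₂v₁` of the curl `∇ × v`. -/
def curl3 (v : R3 → R3) : R3 → ℝ := fun x => pd 0 (comp v 1) x - pd 1 (comp v 0) x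

/-- The pointwise size `|∇v|` (Euclidean norm of all first derivatives). -/
def absGrad (v : R3 → R3) : R3 → ℝ :=
  fun x => √(∑ j : Fin 3, ∑ i : Fin 3, (pd i (comp v j) x) ^ 2)

/-- The pointwise size `|∇_h v|`, where `∇_h = (∂₁, ∂₂, 0)`. -/
def absGradH (v : R3 → R3) : R3 → ℝ :=
  fun x => √(∑ j : Fin 3, ((pd 0 (comp v j) x) ^ 2 + (pd 1 (comp v j) x) ^ 2))

/-- The pointwise size `|∇∇_h v|`. -/
def absGradGradH (v : R3 → R3) : R3 → ℝ :=
  fun x => √(∑ j : Fin 3, ∑ i : Fin 3,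
    ((pd i (pd 0 (comp v j)) x) ^ 2 + (pd i (pd 1 (comp v j)) x) ^ 2))

/-- The Fourier symbol `ξᵢ ξⱼ / (ξ₁² + ξ₂²)` of `∂ᵢ∂ⱼ Δ_h⁻¹`: the quotient of the symbols
`(2π√-1 ξᵢ)(2π√-1 ξⱼ)` of `∂ᵢ∂ⱼ` and `-4π²(ξ₁² + ξ₂²)` of `Δ_h`. It is used for `i, j ∈ {1, 2}`
only (indices `0` and `1`); its value on the null set `ξ₁ = ξ₂ = 0` is irrelevant. -/
def horizSymbol (i j : Fin 2) (ξ : R3) : ℝ :=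
  ξ i.castSucc * ξ j.castSucc / (ξ 0 ^ 2 + ξ 1 ^ 2)

theorem abs_horizSymbol_le (i j : Fin 2) (ξ : R3) : |horizSymbol i j ξ| ≤ 1 := by
  have h0 : (0 : ℝ) ≤ ξ 0 ^ 2 + ξ 1 ^ 2 := by positivity
  have key : |ξ i.castSucc * ξ j.castSucc| ≤ ξ 0 ^ 2 + ξ 1 ^ 2 := by
    rw [abs_le]
    fin_cases i <;> fin_cases j <;> simp <;> constructor <;>
      nlinarith [sq_nonneg (ξ 0 + ξ 1), sq_nonneg (ξ 0 - ξ 1), sq_nonneg (ξ 0), sq_nonneg (ξ 1)]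
  unfold horizSymbol
  rw [abs_div, abs_of_nonneg h0]
  exact div_le_one_of_le₀ key h0

theorem measurable_horizSymbol (i j : Fin 2) : Measurable (horizSymbol i j) := by
  unfold horizSymbol
  fun_prop

theorem memLp_horizSymbol_mul (i j : Fin 2) (g : Lp ℂ 2 (volume : Measure R3)) :
    MemLp (fun ξ : R3 => (horizSymbol i j ξ : ℂ) * g ξ) 2 volume := by
  refine (Lp.memLp g).of_le ?_ (Filter.Eventually.of_forall fun ξ => ?_)
  · exact (Complex.measurable_ofReal.comp (measurable_horizSymbol i j)).aestronglyMeasurable.mul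
      (Lp.aestronglyMeasurable g)
  · rw [norm_mul, Complex.norm_real, Real.norm_eq_abs]
    exact mul_le_of_le_one_left (norm_nonneg _) (abs_horizSymbol_le i j ξ)

/-- The operator `∂ᵢ∂ⱼ Δ_h⁻¹`, `i, j ∈ {1, 2}`, on `L²(ℝ³)`: the Fourier multiplier operator
with symbol `horizSymbol i j`. -/
def horizRieszL2 (i j : Fin 2) (f : Lp ℂ 2 (volume : Measure R3)) :
    Lp ℂ 2 (volume : Measure R3) :=
  (Lp.fourierTransformₗᵢ R3 ℂ).symm
    (memLp_horizSymbol_mul i j (Lp.fourierTransformₗᵢ R3 ℂ f)).toLp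

open Classical in
/-- `∂ᵢ∂ⱼ Δ_h⁻¹ f` for a real function `f ∈ L²(ℝ³)` (and the junk value `0` if `f ∉ L²`). -/
def horizRiesz (i j : Fin 2) (f : R3 → ℝ) : R3 → ℂ :=
  if hf : MemLp (fun x => (f x : ℂ)) 2 (volume : Measure R3) then
    (horizRieszL2 i j hf.toLp : R3 → ℂ)
  else 0

/-- The pointwise size `|∇_h² Δ_h⁻¹ f|` (Euclidean norm of the four entries). -/
def absHorizRiesz (f : R3 → ℝ) : R3 → ℝ :=
  fun x => √(∑ i : Fin 2, ∑ j : Fin 2, ‖horizRiesz i j f x‖ ^ 2)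

/-- `v ∈ H²(ℝ³)` for a smooth vector field `v`: `v` and its partial derivatives of first and
second order are square integrable. -/
structure MemH2 (v : R3 → R3) : Prop where
  zero : ∀ j, MemLp (comp v j) 2 (volume : Measure R3)
  one : ∀ i j, MemLp (pd i (comp v j)) 2 (volume : Measure R3)
  two : ∀ i k j, MemLp (pd i (pd k (comp v j))) 2 (volume : Measure R3)

/-- `(u, b, p)` is a smooth solution on `ℝ³ × (0, T)` of the MHD system with unit viscosity and
unit magnetic diffusivity:
`∂ₜu + (u·∇)u + ∇p = Δu + (b·∇)b`, `∂ₜb + (u·∇)b = Δb + (b·∇)u`, `∇·u = ∇·b = 0`. -/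
structure IsSmoothMHDSolution (T : ℝ) (u b : ℝ → R3 → R3) (p : ℝ → R3 → ℝ) : Prop where
  smooth_u : ContDiffOn ℝ (⊤ : ℕ∞) (fun z : ℝ × R3 => u z.1 z.2) (Set.Ioo 0 T ×ˢ Set.univ)
  smooth_b : ContDiffOn ℝ (⊤ : ℕ∞) (fun z : ℝ × R3 => b z.1 z.2) (Set.Ioo 0 T ×ˢ Set.univ)
  smooth_p : ContDiffOn ℝ (⊤ : ℕ∞) (fun z : ℝ × R3 => p z.1 z.2) (Set.Ioo 0 T ×ˢ Set.univ)
  momentum : ∀ t ∈ Set.Ioo 0 T, ∀ x, ∀ j : Fin 3,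
    deriv (fun s => u s x j) t + advect (u t) (u t) j x + pd j (p t) x
      = lap (comp (u t) j) x + advect (b t) (b t) j x
  induction : ∀ t ∈ Set.Ioo 0 T, ∀ x, ∀ j : Fin 3,
    deriv (fun s => b s x j) t + advect (u t) (b t) j x
      = lap (comp (b t) j) x + advect (b t) (u t) j x
  div_u : ∀ t ∈ Set.Ioo 0 T, ∀ x, divergence (u t) x = 0
  div_b : ∀ t ∈ Set.Ioo 0 T, ∀ x, divergence (b t) x = 0

/-- `(u·∇)u·Δ_h u - (b·∇)b·Δ_h u + (u·∇)b·Δ_h b - (b·∇)u·Δ_h b`. -/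
def nonlinearTerms (u b : R3 → R3) : R3 → ℝ := fun x =>
  (∑ j : Fin 3, advect u u j x * lapH (comp u j) x)
    - (∑ j : Fin 3, advect b b j x * lapH (comp u j) x)
    + (∑ j : Fin 3, advect u b j x * lapH (comp b j) x)
    - (∑ j : Fin 3, advect b u j x * lapH (comp b j) x)

/-- `|u₃| (|∇u| |∇∇_h u| + |∇b| |∇∇_h b|) + |b₃| (|∇u| |∇∇_h b| + |∇b| |∇∇_h u|)
+ |∇_h b|² |∇_h² Δ_h⁻¹ ω₃| + |∇_h² Δ_h⁻¹ u₃| |∇∇_h b| |∇_h b|`, where `ω = ∇ × u`. -/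
def majorant (u b : R3 → R3) : R3 → ℝ := fun x =>
  |u x 2| * (absGrad u x * absGradGradH u x + absGrad b x * absGradGradH b x)
    + |b x 2| * (absGrad u x * absGradGradH b x + absGrad b x * absGradGradH u x)
    + absGradH b x ^ 2 * absHorizRiesz (curl3 u) x
    + absHorizRiesz (comp u 2) x * absGradGradH b x * absGradH b x

end

open Filter Topology
open scoped ContDiff
open FourierTransform SchwartzMap LineDeriv

/-! Fix the time and let `k` be a horizontal index. Moving one of the two derivatives `∂ₖ` off
`∂ₖ∂ₖ` by parts turns each transport term into a product of three first derivatives plus a term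
carrying a transported second derivative. The latter cancel after summation: the `u`-transport terms
are halves of `u·∇` of a square, and the two `b`-transport terms combine to `b·∇(∂ₖb·∂ₖu)`, so all
of them integrate to zero since `u` and `b` are solenoidal. What is left is the sum of `cubicTerm u
b k i j`.

If `i` or `j` is vertical, every product has a factor `∂ₘu₃` or `∂ₘb₃` with `m` horizontal.
Integrating this `∂ₘ` by parts leaves `u₃` or `b₃` times a gradient times a second derivative with a
horizontal index (`controlled_of_vertical`).

If all indices are horizontal, write `A` and `B` for the 2×2 horizontal gradients of the horizontal
parts of `u` and `b`. Cayley-Hamilton extracts factors `tr A = -∂₃u₃` and `tr B = -∂₃b₃`, handled as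
before, and leaves `tr(A(BᵀB - BBᵀ))` (`sum_horizontal_cubicTerm`). Here `A` is replaced by
horizontal Riesz transforms of `ω₃` and `∂₃u₃` (`pd_fst_eq_horizRiesz`, `pd_snd_eq_horizRiesz`). The
`ω₃` part is bounded pointwise by the majorant; in the other part `∂₃` commutes with the Riesz
transform and is moved onto the quadratic expression in `b` (`integral_mul_mul_horizRiesz_pd`).

Integrability and the absence of boundary terms rest on two embeddings in dimension three: `H¹ ⊂ L⁴`
for first derivatives (`SmoothH1.memLp_four`), and `H² ⊂ L^∞` for the fields and for the Riesz
transforms of `u₃` (`SmoothH2.exists_bound`, `SmoothH2.exists_bound_horizRiesz`). -/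

/-- A smooth function which is square integrable together with its first derivatives. -/
structure SmoothH1 (f : R3 → ℝ) : Prop where
  smooth : ContDiff ℝ ∞ f
  zero : MemLp f 2 volume
  one : ∀ i, MemLp (pd i f) 2 volume

/-- A smooth function which is square integrable together with its derivatives of order at most
two. -/
structure SmoothH2 (f : R3 → ℝ) : Prop where
  smooth : ContDiff ℝ ∞ f
  zero : MemLp f 2 volume
  one : ∀ i, MemLp (pd i f) 2 volume
  two : ∀ i k, MemLp (pd i (pd k f)) 2 volume

/-! ### Calculus of partial derivatives -/

theorem contDiff_pd {f : R3 → ℝ} (hf : ContDiff ℝ ∞ f) (i : Fin 3) : ContDiff ℝ ∞ (pd i f) := by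
  unfold pd
  exact (hf.fderiv_right (m := ∞) (by simp)).clm_apply contDiff_const

theorem SmoothH2.toSmoothH1 {f : R3 → ℝ} (hf : SmoothH2 f) : SmoothH1 f :=
  ⟨hf.smooth, hf.zero, hf.one⟩

theorem SmoothH2.deriv {f : R3 → ℝ} (hf : SmoothH2 f) (k : Fin 3) : SmoothH1 (pd k f) :=
  ⟨contDiff_pd hf.smooth k, hf.one k, fun i => hf.two i k⟩

theorem pd_mul {f g : R3 → ℝ} (hf : ContDiff ℝ ∞ f) (hg : ContDiff ℝ ∞ g) (i : Fin 3) (x : R3) :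
    pd i (fun y => f y * g y) x = pd i f x * g x + f x * pd i g x := by
  have hf' := (hf.differentiable (by simp)) x
  have hg' := (hg.differentiable (by simp)) x
  simp only [pd]
  rw [fderiv_fun_mul hf' hg']
  simp
  ring

theorem pd_comm {f : R3 → ℝ} (hf : ContDiff ℝ ∞ f) (i k : Fin 3) (x : R3) :
    pd i (pd k f) x = pd k (pd i f) x := by
  have hd : Differentiable ℝ (fderiv ℝ f) :=
    (hf.fderiv_right (m := ∞) (by simp)).differentiable (by simp)
  have hs : IsSymmSndFDerivAt ℝ f x :=
    (hf.contDiffAt).isSymmSndFDerivAt (by rw [minSmoothness_of_isRCLikeNormedField]; exact WithTop.coe_le_coe.2 (le_top : (2 : ℕ∞) ≤ ⊤))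
  have key : ∀ v w : R3, fderiv ℝ (fun y => fderiv ℝ f y v) x w = fderiv ℝ (fderiv ℝ f) x w v := by
    intro v w
    rw [fderiv_clm_apply (hd x) (by simp)]
    simp
  change fderiv ℝ (fun y => fderiv ℝ f y _) x _ = fderiv ℝ (fun y => fderiv ℝ f y _) x _
  rw [key, key]
  exact hs.eq _ _

theorem norm_fderiv_le_sum_pd (f : R3 → ℝ) (x : R3) :
    ‖fderiv ℝ f x‖ ≤ ∑ i, ‖pd i f x‖ := by
  refine ContinuousLinearMap.opNorm_le_bound _ (by positivity) fun v => ?_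
  have hv : v = ∑ i, v i • EuclideanSpace.single i (1 : ℝ) := by
    ext j; fin_cases j <;> simp [Fin.sum_univ_three]
  conv_lhs => rw [hv, map_sum]
  refine (norm_sum_le _ _).trans ?_
  rw [Finset.sum_mul]
  refine Finset.sum_le_sum fun i _ => ?_
  rw [map_smul, norm_smul, mul_comm]
  exact mul_le_mul_of_nonneg_left (PiLp.norm_apply_le v i) (norm_nonneg _)

/-! ### Cutoff functions with uniformly bounded gradients -/

/-- A smooth bump function equal to `1` on the unit ball. -/
def unitBump : ContDiffBump (0 : R3) := ⟨1, 2, one_pos, one_lt_two⟩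

/-- Smooth cutoff functions exhausting space. -/
noncomputable def cutoff (n : ℕ) (x : R3) : ℝ := unitBump (((n : ℝ) + 1)⁻¹ • x)

theorem cutoff_contDiff (n : ℕ) : ContDiff ℝ ∞ (cutoff n) :=
  unitBump.contDiff.comp (contDiff_const_smul _)

theorem cutoff_hasCompactSupport (n : ℕ) : HasCompactSupport (cutoff n) :=
  unitBump.hasCompactSupport.comp_smul (by positivity)

theorem abs_cutoff_le (n : ℕ) (x : R3) : |cutoff n x| ≤ 1 := by
  rw [cutoff, abs_of_nonneg unitBump.nonneg]
  exact unitBump.le_one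

theorem cutoff_eventually_eq_one (x : R3) : ∀ᶠ n : ℕ in atTop, cutoff n =ᶠ[𝓝 x] 1 := by
  filter_upwards [eventually_gt_atTop ⌈‖x‖⌉₊] with n hn
  have hx : ‖x‖ < n := Nat.lt_of_ceil_lt hn
  have : ∀ᶠ y in 𝓝 x, ‖y‖ < n := continuous_norm.continuousAt.eventually_lt_const hx
  filter_upwards [this] with y hy
  refine unitBump.one_of_mem_closedBall ?_
  rw [mem_closedBall_zero_iff, norm_smul, norm_inv, Real.norm_of_nonneg (by positivity)]
  change _ ≤ (1 : ℝ)
  rw [inv_mul_le_iff₀ (by positivity)]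
  linarith

theorem exists_norm_fderiv_cutoff_le : ∃ C, ∀ n x, ‖fderiv ℝ (cutoff n) x‖ ≤ C := by
  have hc : Continuous (fderiv ℝ (unitBump : R3 → ℝ)) :=
    (unitBump.contDiff (n := 1)).continuous_fderiv (by simp)
  obtain ⟨C, hC⟩ := (unitBump.hasCompactSupport.fderiv (𝕜 := ℝ)).exists_bound_of_continuous hc
  refine ⟨C, fun n x => ?_⟩
  have hd : DifferentiableAt ℝ (unitBump : R3 → ℝ) (((n : ℝ) + 1)⁻¹ • x) :=
    (unitBump.contDiff (n := 1)).differentiable (by simp) _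
  have h : fderiv ℝ (cutoff n) x =
      ((n : ℝ) + 1)⁻¹ • fderiv ℝ (unitBump : R3 → ℝ) (((n : ℝ) + 1)⁻¹ • x) := by
    exact fderiv_comp_smul _
  rw [h, norm_smul, norm_inv, Real.norm_of_nonneg (by positivity)]
  refine (mul_le_of_le_one_left (norm_nonneg _) ?_).trans (hC _)
  exact inv_le_one_of_one_le₀ (by linarith [(Nat.cast_nonneg n : (0:ℝ) ≤ n)])

theorem tendsto_cutoff (x : R3) : Tendsto (fun n => cutoff n x) atTop (𝓝 1) :=
  tendsto_const_nhds.congr' <| by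
    filter_upwards [cutoff_eventually_eq_one x] with n hn using hn.eq_of_nhds.symm

theorem tendsto_pd_cutoff (i : Fin 3) (x : R3) :
    Tendsto (fun n => pd i (cutoff n) x) atTop (𝓝 0) :=
  tendsto_const_nhds.congr' <| by
    filter_upwards [cutoff_eventually_eq_one x] with n hn
    rw [pd, hn.fderiv_eq]
    simp [Pi.one_def]

theorem exists_abs_pd_cutoff_le : ∃ C, 0 ≤ C ∧ ∀ n i x, |pd i (cutoff n) x| ≤ C := by
  obtain ⟨C, hC⟩ := exists_norm_fderiv_cutoff_le
  refine ⟨C, (norm_nonneg _).trans (hC 0 0), fun n i x => ?_⟩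
  have := (fderiv ℝ (cutoff n) x).le_opNorm (EuclideanSpace.single i (1 : ℝ))
  rw [PiLp.norm_single, norm_one, mul_one] at this
  exact this.trans (hC n x)

/-! ### Sobolev embedding of `H¹` and products of `H¹` functions -/

theorem SmoothH1.memLp_fderiv {f : R3 → ℝ} (hf : SmoothH1 f) :
    MemLp (fderiv ℝ f) 2 volume := by
  have h : MemLp (fun x => ∑ i, ‖pd i f x‖) 2 volume :=
    memLp_finsetSum _ fun i _ => (hf.one i).norm
  refine h.of_le ?_ (Eventually.of_forall fun x => ?_)
  · exact (hf.smooth.continuous_fderiv (by simp)).aestronglyMeasurable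
  · exact (norm_fderiv_le_sum_pd f x).trans (Real.le_norm_self _)

/-- The Gagliardo-Nirenberg-Sobolev inequality (`1/6 = 1/2 - 1/3`) applies to the compactly
supported truncations. Their gradients are dominated by `|∇f| + C|f|` uniformly in `n`, and Fatou's
lemma passes to the limit. -/
theorem SmoothH1.memLp_six {f : R3 → ℝ} (hf : SmoothH1 f) : MemLp f 6 volume := by
  obtain ⟨C, hC⟩ := exists_norm_fderiv_cutoff_le
  have hC0 : 0 ≤ C := (norm_nonneg _).trans (hC 0 0)
  have hF : MemLp (fun x => ‖fderiv ℝ f x‖ + C * ‖f x‖) 2 volume :=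
    hf.memLp_fderiv.norm.add (hf.zero.norm.const_mul C)
  have hsm : ∀ n, ContDiff ℝ ∞ (fun x => cutoff n x * f x) := fun n =>
    (cutoff_contDiff n).mul hf.smooth
  have hb : ∀ n, eLpNorm (fun x => cutoff n x * f x) 6 volume ≤
      SNormLESNormFDerivOfEqConst ℝ (volume : Measure R3) 2 *
        eLpNorm (fun x => ‖fderiv ℝ f x‖ + C * ‖f x‖) 2 volume := by
    intro n
    have := eLpNorm_le_eLpNorm_fderiv_of_eq (volume : Measure R3) (p := 2) (p' := 6)
      ((hsm n).of_le (by simp)) ((cutoff_hasCompactSupport n).mul_right (f' := f))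
      (by norm_num) (by simp) (by simp; norm_num)
    refine this.trans (mul_le_mul' le_rfl (eLpNorm_mono_real fun x => ?_))
    rw [fderiv_fun_mul ((cutoff_contDiff n).differentiable (by simp) x)
      (hf.smooth.differentiable (by simp) x)]
    refine (norm_add_le _ _).trans ?_
    rw [norm_smul, norm_smul, mul_comm ‖f x‖]
    gcongr
    · exact mul_le_of_le_one_left (norm_nonneg _) (abs_cutoff_le n x)
    · exact hC n x
  refine ⟨hf.smooth.continuous.aestronglyMeasurable, ?_⟩
  have hlt := ENNReal.mul_lt_top (ENNReal.coe_lt_top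
    (r := SNormLESNormFDerivOfEqConst ℝ (volume : Measure R3) 2)) hF.2
  refine lt_of_le_of_lt (Lp.eLpNorm_lim_le_liminf_eLpNorm
    (fun n => (hsm n).continuous.aestronglyMeasurable) f
    (Eventually.of_forall fun x => by simpa using (tendsto_cutoff x).mul_const (f x))) ?_
  refine lt_of_le_of_lt (liminf_le_of_le (h := ?_)) hlt
  intro b hb'
  obtain ⟨n, hn⟩ := hb'.exists
  exact hn.trans (hb n)

theorem SmoothH1.memLp_four {f : R3 → ℝ} (hf : SmoothH1 f) : MemLp f 4 volume := by
  have h6 := hf.memLp_six.integrable_norm_pow (by norm_num)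
  have h2 := hf.zero.integrable_norm_pow (by norm_num)
  have hm := hf.smooth.continuous.aestronglyMeasurable (μ := volume)
  have h4 : Integrable (fun x => ‖f x‖ ^ 4) volume := by
    refine (h2.add h6).mono' (hm.norm.pow 4) (Eventually.of_forall fun x => ?_)
    simp only [norm_pow, norm_norm, Pi.add_apply]
    -- Interpolation in pointwise form: `y⁴ ≤ y² + y⁶`, from `y²(y² - 1)² ≥ 0`.
    nlinarith [sq_nonneg (‖f x‖ * (‖f x‖ ^ 2 - 1)), sq_nonneg (‖f x‖), sq_nonneg (‖f x‖ ^ 3)]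
  rw [← integrable_norm_rpow_iff hm (by norm_num) (by norm_num)]
  simpa using mod_cast h4

theorem SmoothH1.memLp_mul {f g : R3 → ℝ} (hf : SmoothH1 f) (hg : SmoothH1 g) :
    MemLp (fun x => f x * g x) 2 volume := by
  have : ENNReal.HolderTriple 4 4 2 := ⟨by
    rw [← ENNReal.toReal_eq_toReal_iff' (by simp) (by simp), ENNReal.toReal_add (by simp) (by simp)]
    norm_num⟩
  exact hg.memLp_four.mul' hf.memLp_four

/-! ### Integration by parts on the whole space -/

/-- If a smooth function and one of its partial derivatives are integrable, then this partial
derivative has integral zero. -/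
theorem integral_pd_eq_zero {F : R3 → ℝ} (hF : ContDiff ℝ ∞ F) (i : Fin 3)
    (h0 : Integrable F volume) (h1 : Integrable (pd i F) volume) : ∫ x, pd i F x = 0 := by
  have := integral_mul_fderiv_eq_neg_fderiv_mul_of_integrable (μ := (volume : Measure R3))
    (f := fun _ => (1 : ℝ)) (g := F) (v := EuclideanSpace.single i 1)
    (by simp) (by simpa using! h1) (by simpa using h0)
    (fun x _ => by fun_prop) (fun x _ => hF.differentiable (by simp) x)
  simpa [pd] using this

theorem integrable_mul_of_memLp_two {f g : R3 → ℝ} (hf : MemLp f 2 volume)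
    (hg : MemLp g 2 volume) : Integrable (fun x => f x * g x) volume :=
  hf.integrable_mul hg

theorem integrable_bdd_mul {f g : R3 → ℝ} (hf : Continuous f) (hb : ∃ C, ∀ x, |f x| ≤ C)
    (hg : Integrable g volume) : Integrable (fun x => f x * g x) volume := by
  obtain ⟨C, hC⟩ := hb
  exact hg.bdd_mul hf.aestronglyMeasurable (Eventually.of_forall hC)

theorem integrable_pd_mul_mul {f g h : R3 → ℝ} (hf : SmoothH1 f)
    (hg : SmoothH1 g) (hh : SmoothH1 h) (m : Fin 3) :
    Integrable (fun x => pd m f x * g x * h x) volume := by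
  simpa only [mul_assoc] using integrable_mul_of_memLp_two (hf.one m) (hg.memLp_mul hh)

theorem integrable_mul_pd_mul {f g h : R3 → ℝ} (hf : SmoothH1 f) (hb : ∃ C, ∀ x, |f x| ≤ C)
    (hg : SmoothH1 g) (hh : SmoothH1 h) (m : Fin 3) :
    Integrable (fun x => f x * pd m g x * h x) volume := by
  simpa only [mul_assoc] using integrable_bdd_mul hf.smooth.continuous hb
    (integrable_mul_of_memLp_two (hg.one m) hh.zero)

theorem integrable_mul_mul_pd {f g h : R3 → ℝ} (hf : SmoothH1 f) (hb : ∃ C, ∀ x, |f x| ≤ C)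
    (hg : SmoothH1 g) (hh : SmoothH1 h) (m : Fin 3) :
    Integrable (fun x => f x * g x * pd m h x) volume := by
  simpa only [mul_assoc] using integrable_bdd_mul hf.smooth.continuous hb
    (integrable_mul_of_memLp_two hg.zero (hh.one m))

/-- Each of the three products is integrable: when `f` is differentiated, `g h` is in `L²` by the
`L⁴` embedding; otherwise `f` is bounded and the other two factors are in `L²`. -/
theorem integral_pd_triple {f g h : R3 → ℝ} (hf : SmoothH1 f) (hb : ∃ C, ∀ x, |f x| ≤ C)
    (hg : SmoothH1 g) (hh : SmoothH1 h) (m : Fin 3) :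
    ∫ x, (pd m f x * g x * h x + f x * pd m g x * h x + f x * g x * pd m h x) = 0 := by
  have hgh := hg.smooth.mul hh.smooth
  have key : pd m (fun x => f x * (g x * h x)) =
      fun x => pd m f x * g x * h x + f x * pd m g x * h x + f x * g x * pd m h x := by
    funext x
    rw [pd_mul hf.smooth hgh, pd_mul hg.smooth hh.smooth]
    ring
  rw [← key]
  refine integral_pd_eq_zero (hf.smooth.mul hgh) m ?_ ?_
  · exact integrable_bdd_mul hf.smooth.continuous hb (integrable_mul_of_memLp_two hg.zero hh.zero)
  · rw [key]
    exact ((integrable_pd_mul_mul hf hg hh m).add (integrable_mul_pd_mul hf hb hg hh m)).add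
      (integrable_mul_mul_pd hf hb hg hh m)

/-! ### Derivatives and the Fourier transform on `L²` -/

theorem ae_eq_of_toTemperedDistribution_test {F G : R3 → ℂ} (hF : LocallyIntegrable F volume)
    (hG : LocallyIntegrable G volume)
    (h : ∀ φ : 𝓢(R3, ℂ), HasCompactSupport φ → ∫ x, φ x • F x = ∫ x, φ x • G x) :
    F =ᵐ[volume] G := by
  refine ae_eq_of_integral_contDiff_smul_eq hF hG fun g hg hc => ?_
  have hc' : HasCompactSupport (Complex.ofRealCLM ∘ g) := hc.comp_left rfl
  have hg' : ContDiff ℝ ∞ (Complex.ofRealCLM ∘ g) := by fun_prop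
  simpa using h (hc'.toSchwartzMap hg') (by simpa using! hc')

/-- The relation between the Fourier transforms of an `L²` function and of its distributional
partial derivative. -/
theorem lineDeriv_eq_iff_fourier (i : Fin 3) (F G : Lp ℂ 2 (volume : Measure R3)) :
    ∂_{(EuclideanSpace.single i (1 : ℝ) : R3)} (F : 𝓢'(R3, ℂ)) = (G : 𝓢'(R3, ℂ)) ↔
      ∀ᵐ ξ : R3, (𝓕 G : Lp ℂ 2 (volume : Measure R3)) ξ =
        2 * Real.pi * Complex.I * (ξ i : ℂ) * (𝓕 F : Lp ℂ 2 (volume : Measure R3)) ξ := by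
  have hF2 := Lp.memLp (𝓕 F : Lp ℂ 2 (volume : Measure R3))
  have hG2 := Lp.memLp (𝓕 G : Lp ℂ 2 (volume : Measure R3))
  have htg : (fun ξ : R3 => (inner ℝ ξ (EuclideanSpace.single i (1 : ℝ) : R3))).HasTemperateGrowth := by
    fun_prop
  have key : ∀ φ : 𝓢(R3, ℂ),
      𝓕 (∂_{(EuclideanSpace.single i (1 : ℝ) : R3)} (F : 𝓢'(R3, ℂ))) φ =
      ∫ ξ : R3, φ ξ • (2 * Real.pi * Complex.I * (ξ i : ℂ) *
        (𝓕 F : Lp ℂ 2 (volume : Measure R3)) ξ) := by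
    intro φ
    rw [TemperedDistribution.fourier_lineDerivOp_eq, Lp.fourier_toTemperedDistribution_eq]
    have h2 : (fun ξ : R3 => ((inner ℝ ξ (EuclideanSpace.single i (1 : ℝ) : R3) : ℝ) : ℂ)).HasTemperateGrowth := by
      fun_prop
    simp [TemperedDistribution.smulLeftCLM_apply_apply, SchwartzMap.smulLeftCLM_apply_apply h2]
    rw [← integral_const_mul]
    congr 1
    ext ξ
    rw [EuclideanSpace.inner_single_right]
    simp
    ring
  constructor
  · intro h
    refine ae_eq_of_toTemperedDistribution_test (hG2.locallyIntegrable (by norm_num)) ?_ ?_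
    · refine LocallyIntegrable.continuous_smul (𝕜 := ℂ) ?_ (hF2.locallyIntegrable (by norm_num))
      fun_prop
    · intro φ _
      rw [← key, h, Lp.fourier_toTemperedDistribution_eq]
      simp
  · intro h
    refine (fourierEquiv ℂ 𝓢'(R3, ℂ)).injective ?_
    ext φ
    change 𝓕 (∂_{(EuclideanSpace.single i (1 : ℝ) : R3)} (F : 𝓢'(R3, ℂ))) φ = 𝓕 (G : 𝓢'(R3, ℂ)) φ
    rw [key, Lp.fourier_toTemperedDistribution_eq, Lp.toTemperedDistribution_apply]
    refine integral_congr_ae ?_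
    filter_upwards [h] with ξ hξ
    rw [hξ]

/-- The Fourier transform of a real function in `L²`. -/
noncomputable def ft {f : R3 → ℝ} (hf : MemLp f 2 volume) : Lp ℂ 2 (volume : Measure R3) :=
  𝓕 (hf.ofReal (K := ℂ)).toLp

/-- Classical and distributional derivatives agree by integration by parts against a Schwartz
function; all products are integrable as products of two `L²` functions. -/
theorem lineDeriv_toLp_ofReal {f : R3 → ℝ} (hf : SmoothH1 f) (i : Fin 3) :
    ∂_{(EuclideanSpace.single i (1 : ℝ) : R3)}
      (((hf.zero.ofReal (K := ℂ)).toLp : Lp ℂ 2 (volume : Measure R3)) : 𝓢'(R3, ℂ)) =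
      (((hf.one i).ofReal (K := ℂ)).toLp : Lp ℂ 2 (volume : Measure R3)) := by
  ext φ
  have h0 := (hf.zero.ofReal (K := ℂ))
  have h1 := ((hf.one i).ofReal (K := ℂ))
  have hd : Differentiable ℝ f := hf.smooth.differentiable (by simp)
  have hfd : ∀ x, fderiv ℝ (fun x => (f x : ℂ)) x (EuclideanSpace.single i (1 : ℝ)) = pd i f x := by
    intro x
    have := (Complex.ofRealCLM.hasFDerivAt.comp x (hd x).hasFDerivAt).fderiv
    change fderiv ℝ (Complex.ofRealCLM ∘ f) x _ = _
    rw [this]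
    simp [pd]
  have hp : MemLp φ 2 (volume : Measure R3) := φ.memLp 2 _
  have hdp : MemLp (∂_{(EuclideanSpace.single i (1 : ℝ) : R3)} φ : 𝓢(R3, ℂ)) 2 (volume : Measure R3) :=
    SchwartzMap.memLp _ 2 _
  have ibp := integral_mul_fderiv_eq_neg_fderiv_mul_of_integrable (μ := (volume : Measure R3))
    (f := φ) (g := fun x => (f x : ℂ)) (v := EuclideanSpace.single i 1)
    (by simpa only [SchwartzMap.lineDerivOp_apply_eq_fderiv] using! hdp.integrable_mul h0)
    (by simpa only [hfd] using! hp.integrable_mul h1) (hp.integrable_mul h0)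
    (fun x _ => φ.differentiableAt)
    (fun x _ => (Complex.ofRealCLM.differentiableAt.comp x (hd x)))
  simp only [hfd] at ibp
  simp only [TemperedDistribution.lineDerivOp_apply_apply, Lp.toTemperedDistribution_apply]
  have e0 : ∫ x, (-∂_{(EuclideanSpace.single i (1 : ℝ) : R3)} φ) x • h0.toLp _ x =
      ∫ x, - (fderiv ℝ φ x (EuclideanSpace.single i 1) * (f x : ℂ)) := by
    refine integral_congr_ae ?_
    filter_upwards [h0.coeFn_toLp] with x hx
    rw [hx]
    simp [SchwartzMap.lineDerivOp_apply_eq_fderiv]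
  have e1 : ∫ x, φ x • h1.toLp _ x = ∫ x, φ x * (pd i f x : ℂ) := by
    refine integral_congr_ae ?_
    filter_upwards [h1.coeFn_toLp] with x hx
    rw [hx]
    simp
  rw [e0, e1, ibp, integral_neg]

theorem ft_pd {f : R3 → ℝ} (hf : SmoothH1 f) (i : Fin 3) :
    ∀ᵐ ξ : R3, ft (hf.one i) ξ = 2 * Real.pi * Complex.I * (ξ i : ℂ) * ft hf.zero ξ :=
  (lineDeriv_eq_iff_fourier i _ _).1 (lineDeriv_toLp_ofReal hf i)

/-! ### Boundedness of `H²` functions -/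

theorem memLp_inv_one_add_norm_sq : MemLp (fun ξ : R3 => ((1 + ‖ξ‖ ^ 2)⁻¹ : ℝ)) 2 volume := by
  have hc : Continuous (fun ξ : R3 => ((1 + ‖ξ‖ ^ 2)⁻¹ : ℝ)) :=
    Continuous.inv₀ (by fun_prop) fun ξ => by positivity
  rw [memLp_two_iff_integrable_sq hc.aestronglyMeasurable]
  have := integrable_rpow_neg_one_add_norm_sq (E := R3) (μ := volume) (r := 4) (by simp; norm_num)
  refine this.congr (Eventually.of_forall fun ξ => ?_)
  change (1 + ‖ξ‖ ^ 2) ^ (-(4 : ℝ) / 2) = ((1 + ‖ξ‖ ^ 2)⁻¹) ^ 2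
  rw [show (-(4 : ℝ) / 2) = -((2 : ℕ) : ℝ) by norm_num, Real.rpow_neg (by positivity),
    Real.rpow_natCast, inv_pow]

/-- With `a` the value of the transform of `f` at `ξ`, the bracket is the transform of `f -
(2π)⁻²Δf`, that is `(1 + |ξ|²) a`. -/
theorem inv_one_add_norm_sq_mul (ξ : R3) (a : ℂ) :
    (((1 + ‖ξ‖ ^ 2)⁻¹ : ℝ) : ℂ) * (a - ((((2 * Real.pi) ^ 2)⁻¹ : ℝ) : ℂ) *
      ∑ i, 2 * Real.pi * Complex.I * (ξ i : ℂ) * (2 * Real.pi * Complex.I * (ξ i : ℂ) * a)) = a := by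
  have hn : ((‖ξ‖ ^ 2 : ℝ) : ℂ) = ∑ i, (ξ i : ℂ) ^ 2 := by
    rw [EuclideanSpace.real_norm_sq_eq]
    push_cast
    rfl
  have hs : ∑ i, 2 * Real.pi * Complex.I * (ξ i : ℂ) * (2 * Real.pi * Complex.I * (ξ i : ℂ) * a) =
      - (((2 * Real.pi) ^ 2 : ℝ) : ℂ) * ((‖ξ‖ ^ 2 : ℝ) : ℂ) * a := by
    rw [hn, Finset.mul_sum, Finset.sum_mul]
    refine Finset.sum_congr rfl fun i _ => ?_
    push_cast
    linear_combination (4 * (Real.pi : ℂ) ^ 2 * (ξ i : ℂ) ^ 2 * a) * Complex.I_sq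
  have hp : ((2 * Real.pi) ^ 2)⁻¹ * (2 * Real.pi) ^ 2 = 1 := inv_mul_cancel₀ (by positivity)
  have hp' : ((((2 * Real.pi) ^ 2)⁻¹ : ℝ) : ℂ) * (((2 * Real.pi) ^ 2 : ℝ) : ℂ) = 1 := by
    exact_mod_cast hp
  have hx : (1 + ‖ξ‖ ^ 2)⁻¹ * (1 + ‖ξ‖ ^ 2) = 1 := inv_mul_cancel₀ (by positivity)
  have hx' : (((1 + ‖ξ‖ ^ 2)⁻¹ : ℝ) : ℂ) * (1 + ((‖ξ‖ ^ 2 : ℝ) : ℂ)) = 1 := by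
    exact_mod_cast hx
  rw [hs]
  linear_combination a * hx' + (((1 + ‖ξ‖ ^ 2)⁻¹ : ℝ) : ℂ) * ((‖ξ‖ ^ 2 : ℝ) : ℂ) * a * hp'

/-- The transform is the product of two `L²` functions: the weight `(1 + |ξ|²)⁻¹`, square integrable
because `4 > 3`, and the transform of `f - (2π)⁻²Δf`. -/
theorem integrable_ft {f : R3 → ℝ} (hf : SmoothH2 f) : Integrable (ft hf.zero) volume := by
  have hs : MemLp (fun ξ : R3 => ∑ i, ft (hf.two i i) ξ) 2 volume :=
    memLp_finsetSum _ fun i _ => Lp.memLp (ft (hf.two i i))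
  have hG : MemLp (fun ξ : R3 => ft hf.zero ξ - ((((2 * Real.pi) ^ 2)⁻¹ : ℝ) : ℂ) *
      ∑ i, ft (hf.two i i) ξ) 2 volume :=
    (Lp.memLp (ft hf.zero)).sub (hs.const_mul _)
  have hw := memLp_inv_one_add_norm_sq.ofReal (K := ℂ)
  refine (hw.integrable_mul hG).congr ?_
  have h1 : ∀ᵐ ξ : R3, ∀ i, ft (hf.one i) ξ = 2 * Real.pi * Complex.I * (ξ i : ℂ) * ft hf.zero ξ :=
    ae_all_iff.2 fun i => ft_pd hf.toSmoothH1 i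
  have h2 : ∀ᵐ ξ : R3, ∀ i, ft (hf.two i i) ξ =
      2 * Real.pi * Complex.I * (ξ i : ℂ) * ft (hf.one i) ξ :=
    ae_all_iff.2 fun i => ft_pd (hf.deriv i) i
  filter_upwards [h1, h2] with ξ h1 h2
  simp only [h1] at h2
  simp only [Pi.mul_apply, h2]
  exact inv_one_add_norm_sq_mul ξ _

/-- The inverse `L²` Fourier transform of an integrable function is bounded. -/
theorem ae_norm_fourierInv_le (g : Lp ℂ 2 (volume : Measure R3)) (hg : Integrable g volume) :
    ∀ᵐ x, ‖(𝓕⁻ g : Lp ℂ 2 (volume : Measure R3)) x‖ ≤ ∫ ξ, ‖g ξ‖ := by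
  have hcont : Continuous (fun p : R3 × R3 => (-innerₗ R3) p.1 p.2) := by
    simp only [LinearMap.neg_apply, innerₗ_apply_apply]
    fun_prop
  -- `T` is the pointwise inverse Fourier integral. It is bounded by the `L¹` norm of `g`, and
  -- agrees with the `L²` inverse transform by testing against Schwartz functions.
  set T : R3 → ℂ := VectorFourier.fourierIntegral Real.fourierChar volume (-innerₗ R3) g with hT
  have hTc : Continuous T :=
    VectorFourier.fourierIntegral_continuous Real.continuous_fourierChar hcont hg
  have hTb : ∀ x, ‖T x‖ ≤ ∫ ξ, ‖g ξ‖ := fun x =>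
    VectorFourier.norm_fourierIntegral_le_integral_norm _ _ _ _ _
  have hae : (𝓕⁻ g : Lp ℂ 2 (volume : Measure R3)) =ᵐ[volume] T := by
    refine ae_eq_of_toTemperedDistribution_test ((Lp.memLp _).locallyIntegrable (by norm_num))
      hTc.locallyIntegrable fun φ _ => ?_
    have h1 : ∫ x, φ x • (𝓕⁻ g : Lp ℂ 2 (volume : Measure R3)) x =
        ((𝓕⁻ g : Lp ℂ 2 (volume : Measure R3)) : 𝓢'(R3, ℂ)) φ := by simp
    rw [h1, ← Lp.fourierInv_toTemperedDistribution_eq, TemperedDistribution.fourierInv_apply,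
      Lp.toTemperedDistribution_apply]
    have := VectorFourier.integral_fourierIntegral_smul_eq_flip (L := -innerₗ R3)
      (μ := volume) (ν := volume) Real.continuous_fourierChar hcont φ.integrable hg
    have hflip : (-innerₗ R3).flip = -innerₗ R3 := by
      ext x y
      simp [real_inner_comm]
    rw [hflip] at this
    rw [← hT] at this
    rw [← this]
    refine integral_congr_ae (Eventually.of_forall fun x => ?_)
    simp only
    congr 1
    rw [SchwartzMap.fourierInv_coe]
    rfl
  filter_upwards [hae] with x hx
  rw [hx]
  exact hTb x

theorem SmoothH2.exists_bound {f : R3 → ℝ} (hf : SmoothH2 f) : ∃ C, ∀ x, |f x| ≤ C := by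
  refine ⟨∫ ξ, ‖ft hf.zero ξ‖, ?_⟩
  have h0 := hf.zero.ofReal (K := ℂ)
  have h := ae_norm_fourierInv_le (ft hf.zero) (integrable_ft hf)
  rw [ft, fourierInv_fourier_eq] at h
  have hd : Dense {x | |f x| ≤ ∫ ξ, ‖ft hf.zero ξ‖} := by
    refine Measure.dense_of_ae (μ := volume) ?_
    filter_upwards [h, h0.coeFn_toLp] with x hx hx'
    rw [hx'] at hx
    simpa [ft] using hx
  -- The bound holds almost everywhere, hence on a dense set, hence everywhere by continuity.
  have hcl : IsClosed {x | |f x| ≤ ∫ ξ, ‖ft hf.zero ξ‖} :=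
    isClosed_le hf.smooth.continuous.abs continuous_const
  intro x
  have : x ∈ closure {x | |f x| ≤ ∫ ξ, ‖ft hf.zero ξ‖} := hd x
  rwa [hcl.closure_eq] at this

/-! ### Horizontal Riesz transforms: boundedness and integration by parts -/

theorem fourier_horizRieszL2 (i j : Fin 2) (F : Lp ℂ 2 (volume : Measure R3)) :
    ∀ᵐ ξ : R3, (𝓕 (horizRieszL2 i j F) : Lp ℂ 2 (volume : Measure R3)) ξ =
      (horizSymbol i j ξ : ℂ) * (𝓕 F : Lp ℂ 2 (volume : Measure R3)) ξ := by
  have h : (𝓕 (horizRieszL2 i j F) : Lp ℂ 2 (volume : Measure R3)) =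
      (memLp_horizSymbol_mul i j (𝓕 F)).toLp :=
    (Lp.fourierTransformₗᵢ R3 ℂ).apply_symm_apply _
  rw [h]
  exact (memLp_horizSymbol_mul i j (𝓕 F)).coeFn_toLp

theorem horizRiesz_of_memLp (i j : Fin 2) {f : R3 → ℝ} (hf : MemLp f 2 volume) :
    horizRiesz i j f = horizRieszL2 i j (hf.ofReal (K := ℂ)).toLp := by
  rw [horizRiesz, dif_pos]
  rfl

theorem memLp_horizRiesz (i j : Fin 2) {f : R3 → ℝ} (hf : MemLp f 2 volume) :
    MemLp (horizRiesz i j f) 2 volume := by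
  rw [horizRiesz_of_memLp i j hf]
  exact Lp.memLp _

/-- A symbol bounded by `1` preserves integrability of the Fourier transform. This substitutes for
`L^∞` boundedness of the Riesz transforms, which is false in general. -/
theorem SmoothH2.exists_bound_horizRiesz {f : R3 → ℝ} (hf : SmoothH2 f) (i j : Fin 2) :
    ∃ C, ∀ᵐ x, ‖horizRiesz i j f x‖ ≤ C := by
  have hF := fourier_horizRieszL2 i j (hf.zero.ofReal (K := ℂ)).toLp
  have hi : Integrable (𝓕 (horizRieszL2 i j (hf.zero.ofReal (K := ℂ)).toLp) :
      Lp ℂ 2 (volume : Measure R3)) volume := by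
    refine (integrable_ft hf).mono (Lp.aestronglyMeasurable _) ?_
    filter_upwards [hF] with ξ hξ
    rw [hξ, norm_mul, Complex.norm_real, Real.norm_eq_abs]
    exact mul_le_of_le_one_left (norm_nonneg _) (abs_horizSymbol_le i j ξ)
  have h := ae_norm_fourierInv_le _ hi
  rw [fourierInv_fourier_eq] at h
  rw [horizRiesz_of_memLp i j hf.zero]
  exact ⟨_, h⟩

/-- The operators `∂ᵢ∂ⱼ Δ_h⁻¹` commute with partial derivatives, tested against smooth functions
of compact support. -/
theorem integral_mul_horizRiesz_pd {f φ : R3 → ℝ} (hf : SmoothH1 f) (i j : Fin 2) (k : Fin 3)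
    (hφ : ContDiff ℝ ∞ φ) (hc : HasCompactSupport φ) :
    ∫ x, (φ x : ℂ) * horizRiesz i j (pd k f) x = - ∫ x, (pd k φ x : ℂ) * horizRiesz i j f x := by
  rw [horizRiesz_of_memLp i j hf.zero, horizRiesz_of_memLp i j (hf.one k)]
  have hc' : HasCompactSupport (fun x => (φ x : ℂ)) := hc.comp_left Complex.ofReal_zero
  have hφ' : ContDiff ℝ ∞ (fun x => (φ x : ℂ)) := Complex.ofRealCLM.contDiff.comp hφ
  have h := (lineDeriv_eq_iff_fourier k (horizRieszL2 i j (hf.zero.ofReal (K := ℂ)).toLp)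
    (horizRieszL2 i j ((hf.one k).ofReal (K := ℂ)).toLp)).2 <| by
      filter_upwards [fourier_horizRieszL2 i j (hf.zero.ofReal (K := ℂ)).toLp,
        fourier_horizRieszL2 i j ((hf.one k).ofReal (K := ℂ)).toLp, ft_pd hf k] with ξ h0 h1 h2
      rw [ft, ft] at h2
      rw [h0, h1, h2]
      ring
  have h' := congrArg (fun T : 𝓢'(R3, ℂ) => T (hc'.toSchwartzMap hφ')) h
  simp only [TemperedDistribution.lineDerivOp_apply_apply, Lp.toTemperedDistribution_apply] at h'
  have hfd : ∀ x, fderiv ℝ (fun x => (φ x : ℂ)) x (EuclideanSpace.single k (1 : ℝ)) =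
      pd k φ x := by
    intro x
    have := (Complex.ofRealCLM.hasFDerivAt.comp x
      (hφ.differentiable (by simp) x).hasFDerivAt).fderiv
    change fderiv ℝ (Complex.ofRealCLM ∘ φ) x _ = _
    rw [this]
    simp [pd]
  refine Eq.trans ?_ (h'.symm.trans ?_)
  · simp
  · rw [← integral_neg]
    refine integral_congr_ae (Eventually.of_forall fun x => ?_)
    have : (∂_{(EuclideanSpace.single k (1 : ℝ) : R3)} (hc'.toSchwartzMap hφ') : 𝓢(R3, ℂ)) x =
        pd k φ x := by
      rw [SchwartzMap.lineDerivOp_apply_eq_fderiv, ← hfd]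
      rfl
    simp [this]

theorem contDiff_of_smoothH1_mul {g h : R3 → ℝ} (hg : SmoothH1 g) (hh : SmoothH1 h) :
    ContDiff ℝ ∞ (fun x => g x * h x) := hg.smooth.mul hh.smooth

theorem integrable_pd_mul {g h : R3 → ℝ} (hg : SmoothH1 g) (hh : SmoothH1 h) (k : Fin 3) :
    Integrable (pd k (fun x => g x * h x)) volume := by
  have : pd k (fun x => g x * h x) = fun x => pd k g x * h x + g x * pd k h x :=
    funext fun x => pd_mul hg.smooth hh.smooth k x
  rw [this]
  exact (integrable_mul_of_memLp_two (hg.one k) hh.zero).add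
    (integrable_mul_of_memLp_two hg.zero (hh.one k))

theorem integrable_mul_horizRiesz {f q : R3 → ℝ} (hf : MemLp f 2 volume) (hq : MemLp q 2 volume)
    (i j : Fin 2) : Integrable (fun x => (q x : ℂ) * horizRiesz i j f x) volume :=
  (hq.ofReal (K := ℂ)).integrable_mul (memLp_horizRiesz i j hf)

theorem integrable_mul_horizRiesz_of_integrable {f q : R3 → ℝ} (hf : SmoothH2 f)
    (hq : Integrable q volume) (i j : Fin 2) :
    Integrable (fun x => (q x : ℂ) * horizRiesz i j f x) volume := by
  obtain ⟨C, hC⟩ := hf.exists_bound_horizRiesz i j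
  exact hq.ofReal.mul_bdd (memLp_horizRiesz i j hf.zero).aestronglyMeasurable hC

/-- The product `g h` is truncated and the cutoff removed by dominated convergence. Its derivative
is known here only to be integrable, so `horizRiesz i j f` must be bounded; this is where `SmoothH2
f` enters. -/
theorem integral_mul_mul_horizRiesz_pd {f g h : R3 → ℝ} (hf : SmoothH2 f) (hg : SmoothH1 g)
    (hh : SmoothH1 h) (i j : Fin 2) (k : Fin 3) :
    ∫ x, ((g x * h x : ℝ) : ℂ) * horizRiesz i j (pd k f) x =
      - ∫ x, ((pd k g x * h x + g x * pd k h x : ℝ) : ℂ) * horizRiesz i j f x := by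
  set q : R3 → ℝ := fun x => g x * h x with hqdef
  have hq : ContDiff ℝ ∞ q := contDiff_of_smoothH1_mul hg hh
  have hq2 : MemLp q 2 volume := hg.memLp_mul hh
  have hq1 : Integrable (pd k q) volume := integrable_pd_mul hg hh k
  have hpq : ∀ x, pd k g x * h x + g x * pd k h x = pd k q x :=
    fun x => (pd_mul hg.smooth hh.smooth k x).symm
  simp only [hpq]
  obtain ⟨C, hC0, hC⟩ := exists_abs_pd_cutoff_le
  have hR1 := integrable_mul_horizRiesz (hf.one k) hq2 i j
  have hR2 := integrable_mul_horizRiesz hf.zero hq2 i j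
  have hR3 := integrable_mul_horizRiesz_of_integrable hf hq1 i j
  have hsm : ∀ n, ContDiff ℝ ∞ (fun x => cutoff n x * q x) := fun n => (cutoff_contDiff n).mul hq
  have hA : Tendsto (fun n => ∫ x, ((cutoff n x * q x : ℝ) : ℂ) * horizRiesz i j (pd k f) x) atTop
      (𝓝 (∫ x, (q x : ℂ) * horizRiesz i j (pd k f) x)) := by
    refine tendsto_integral_of_dominated_convergence _ (fun n => ?_) hR1.norm (fun n => ?_) ?_
    · exact (Complex.continuous_ofReal.comp (hsm n).continuous).aestronglyMeasurable.mul
        (memLp_horizRiesz i j (hf.one k)).aestronglyMeasurable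
    · refine Eventually.of_forall fun x => ?_
      rw [norm_mul, norm_mul, Complex.norm_real, Complex.norm_real, norm_mul]
      gcongr
      exact mul_le_of_le_one_left (norm_nonneg _) (abs_cutoff_le n x)
    · refine Eventually.of_forall fun x => Tendsto.mul_const _ ?_
      exact (Complex.continuous_ofReal.tendsto _).comp (by simpa using (tendsto_cutoff x).mul_const (q x))
  have hB : Tendsto (fun n => ∫ x, ((pd k (fun x => cutoff n x * q x) x : ℝ) : ℂ) *
      horizRiesz i j f x) atTop (𝓝 (∫ x, (pd k q x : ℂ) * horizRiesz i j f x)) := by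
    refine tendsto_integral_of_dominated_convergence
      (fun x => C * ‖(q x : ℂ) * horizRiesz i j f x‖ + ‖(pd k q x : ℂ) * horizRiesz i j f x‖)
      (fun n => ?_) ((hR2.norm.const_mul C).add hR3.norm) (fun n => ?_) ?_
    · exact (Complex.continuous_ofReal.comp
        (contDiff_pd (hsm n) k).continuous).aestronglyMeasurable.mul
        (memLp_horizRiesz i j hf.zero).aestronglyMeasurable
    · refine Eventually.of_forall fun x => ?_
      rw [norm_mul, norm_mul, norm_mul, Complex.norm_real, Complex.norm_real, Complex.norm_real,
        pd_mul (cutoff_contDiff n) hq, ← mul_assoc C, ← add_mul]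
      refine mul_le_mul_of_nonneg_right ((norm_add_le _ _).trans ?_) (norm_nonneg _)
      simp only [norm_mul]
      exact add_le_add (mul_le_mul_of_nonneg_right (hC n k x) (norm_nonneg _))
        (mul_le_of_le_one_left (norm_nonneg _) (abs_cutoff_le n x))
    · refine Eventually.of_forall fun x => Tendsto.mul_const _ ?_
      refine (Complex.continuous_ofReal.tendsto _).comp ?_
      simp only [pd_mul (cutoff_contDiff _) hq]
      simpa using ((tendsto_pd_cutoff k x).mul_const (q x)).add
        ((tendsto_cutoff x).mul_const (pd k q x))
  refine tendsto_nhds_unique hA ?_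
  refine hB.neg.congr fun n => ?_
  exact (integral_mul_horizRiesz_pd hf.toSmoothH1 i j k (hsm n)
    ((cutoff_hasCompactSupport n).mul_right)).symm

/-! ### Horizontal div-curl decomposition -/

theorem ae_horizontal_ne_zero : ∀ᵐ ξ : R3, ξ 0 ^ 2 + ξ 1 ^ 2 ≠ 0 := by
  let P : Submodule ℝ R3 := LinearMap.ker (EuclideanSpace.proj (0 : Fin 3) : R3 →L[ℝ] ℝ).toLinearMap
  have hP : P ≠ ⊤ := by
    intro h
    have : (EuclideanSpace.single (0 : Fin 3) (1 : ℝ) : R3) ∈ P := h ▸ Submodule.mem_top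
    simp [P] at this
  have h0 := Measure.addHaar_submodule (volume : Measure R3) P hP
  filter_upwards [measure_eq_zero_iff_ae_notMem.1 h0] with ξ hξ h
  refine hξ ?_
  have : ξ 0 = 0 := by nlinarith [sq_nonneg (ξ 0), sq_nonneg (ξ 1)]
  simpa [P] using this

theorem fourier_Lp_sub (F G : Lp ℂ 2 (volume : Measure R3)) :
    (𝓕 (F - G) : Lp ℂ 2 (volume : Measure R3)) = 𝓕 F - 𝓕 G :=
  (Lp.fourierTransformₗᵢ R3 ℂ).map_sub F G

theorem fourier_Lp_neg (F : Lp ℂ 2 (volume : Measure R3)) :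
    (𝓕 (-F) : Lp ℂ 2 (volume : Measure R3)) = -𝓕 F :=
  (Lp.fourierTransformₗᵢ R3 ℂ).map_neg F

theorem ft_sub {f g : R3 → ℝ} (hf : MemLp f 2 volume) (hg : MemLp g 2 volume)
    (hfg : MemLp (fun x => f x - g x) 2 volume) : ft hfg = ft hf - ft hg := by
  have : (hfg.ofReal (K := ℂ)).toLp = (hf.ofReal (K := ℂ)).toLp - (hg.ofReal (K := ℂ)).toLp := by
    rw [← MemLp.toLp_sub]
    congr 1
    ext x
    simp
  rw [ft, this, fourier_Lp_sub]
  rfl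

theorem ft_neg {f : R3 → ℝ} (hf : MemLp f 2 volume) (hn : MemLp (fun x => -f x) 2 volume) :
    ft hn = -ft hf := by
  have : (hn.ofReal (K := ℂ)).toLp = -(hf.ofReal (K := ℂ)).toLp := by
    rw [← MemLp.toLp_neg]
    congr 1
    ext x
    simp
  rw [ft, this, fourier_Lp_neg]
  rfl

/-- An identity between horizontal Riesz transforms holds as soon as it holds on the Fourier side. -/
theorem ae_eq_horizRiesz_add {f d w : R3 → ℝ} (hf : MemLp f 2 volume) (hd : MemLp d 2 volume)
    (hw : MemLp w 2 volume) (i j k l : Fin 2) (s t : ℂ)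
    (h : ∀ᵐ ξ : R3, ft hf ξ =
      s * ((horizSymbol i j ξ : ℂ) * ft hw ξ) + t * ((horizSymbol k l ξ : ℂ) * ft hd ξ)) :
    ∀ᵐ x, (f x : ℂ) = s * horizRiesz i j w x + t * horizRiesz k l d x := by
  set W := horizRieszL2 i j (hw.ofReal (K := ℂ)).toLp with hW
  set D := horizRieszL2 k l (hd.ofReal (K := ℂ)).toLp with hD
  have hlin : (𝓕 (s • W + t • D) : Lp ℂ 2 (volume : Measure R3)) = s • 𝓕 W + t • 𝓕 D := by
    have h1 := (Lp.fourierTransformₗᵢ R3 ℂ).map_add (s • W) (t • D)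
    rw [(Lp.fourierTransformₗᵢ R3 ℂ).map_smul, (Lp.fourierTransformₗᵢ R3 ℂ).map_smul] at h1
    exact h1
  have key : (hf.ofReal (K := ℂ)).toLp = s • W + t • D := by
    refine (Lp.fourierTransformₗᵢ R3 ℂ).injective ?_
    change ft hf = (𝓕 (s • W + t • D) : Lp ℂ 2 (volume : Measure R3))
    rw [hlin]
    refine Lp.ext ?_
    filter_upwards [h, Lp.coeFn_add (s • 𝓕 W) (t • 𝓕 D), Lp.coeFn_smul s (𝓕 W),
      Lp.coeFn_smul t (𝓕 D), fourier_horizRieszL2 i j (hw.ofReal (K := ℂ)).toLp,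
      fourier_horizRieszL2 k l (hd.ofReal (K := ℂ)).toLp] with ξ h0 h1 h4 h5 h2 h3
    rw [h1, Pi.add_apply, h4, h5, Pi.smul_apply, Pi.smul_apply, h2, h3]
    exact h0
  rw [horizRiesz_of_memLp i j hw, horizRiesz_of_memLp k l hd]
  have h0 := (hf.ofReal (K := ℂ)).coeFn_toLp
  rw [key] at h0
  filter_upwards [h0, Lp.coeFn_add (s • W) (t • D), Lp.coeFn_smul s W, Lp.coeFn_smul t D]
    with x h0 h1 h2 h3
  rw [h1, Pi.add_apply, h2, h3] at h0
  exact h0.symm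

theorem ft_div_eq {a b c : R3 → ℝ} (ha : SmoothH1 a) (hb : SmoothH1 b)
    (hc : SmoothH1 c) (hdiv : ∀ x, pd 0 a x + pd 1 b x + pd 2 c x = 0) :
    ∀ᵐ ξ : R3, ft (hc.one 2) ξ = - ft (ha.one 0) ξ - ft (hb.one 1) ξ := by
  have hn : MemLp (fun x => - pd 0 a x) 2 volume := (ha.one 0).neg
  have hm : MemLp (fun x => - pd 0 a x - pd 1 b x) 2 volume := hn.sub (hb.one 1)
  have e : pd 2 c = fun x => - pd 0 a x - pd 1 b x := by
    funext x
    linarith [hdiv x]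
  have e' : ft (hc.one 2) = ft hm := by
    unfold ft
    congr 1
    congr 1
    rw [e]
  rw [e', ft_sub hn (hb.one 1), ft_neg (ha.one 0)]
  filter_upwards [Lp.coeFn_sub (-ft (ha.one 0)) (ft (hb.one 1)), Lp.coeFn_neg (ft (ha.one 0))]
    with ξ h1 h2
  rw [h1, Pi.sub_apply, h2, Pi.neg_apply]

/-- Two-dimensional div-curl decomposition of the horizontal gradient of the first horizontal
component. -/
theorem pd_fst_eq_horizRiesz {a b c : R3 → ℝ} (ha : SmoothH1 a) (hb : SmoothH1 b)
    (hc : SmoothH1 c) (hdiv : ∀ x, pd 0 a x + pd 1 b x + pd 2 c x = 0) (k : Fin 2) :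
    ∀ᵐ x, (pd k.castSucc a x : ℂ) = (-1) * horizRiesz k 1 (fun y => pd 0 b y - pd 1 a y) x
      + (-1) * horizRiesz k 0 (pd 2 c) x := by
  have hw : MemLp (fun y => pd 0 b y - pd 1 a y) 2 volume := (hb.one 0).sub (ha.one 1)
  -- With `ω = ∂₀b - ∂₁a` and `∂₀a + ∂₁b = -∂₂c` one has `Δ_h a = -∂₁ω - ∂₀∂₂c`; apply `∂ₖΔ_h⁻¹`.
  refine ae_eq_horizRiesz_add (ha.one k.castSucc) (hc.one 2) hw _ _ _ _ _ _ ?_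
  rw [ft_sub (hb.one 0) (ha.one 1)]
  filter_upwards [Lp.coeFn_sub (ft (hb.one 0)) (ft (ha.one 1)), ft_div_eq ha hb hc hdiv,
    ft_pd ha 0, ft_pd ha 1, ft_pd ha k.castSucc, ft_pd hb 0, ft_pd hb 1, ae_horizontal_ne_zero]
    with ξ h1 h4 a0 a1 ak b0 b1 hξ
  rw [h1, Pi.sub_apply, h4, a0, a1, ak, b0, b1]
  have hξ' : ((ξ 0 : ℂ) ^ 2 + (ξ 1 : ℂ) ^ 2) ≠ 0 := by
    simpa using Complex.ofReal_ne_zero.2 hξ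
  simp only [horizSymbol, Fin.castSucc_zero, Fin.castSucc_one]
  push_cast
  field_simp
  ring

/-- Two-dimensional div-curl decomposition of the horizontal gradient of the second horizontal
component. -/
theorem pd_snd_eq_horizRiesz {a b c : R3 → ℝ} (ha : SmoothH1 a) (hb : SmoothH1 b)
    (hc : SmoothH1 c) (hdiv : ∀ x, pd 0 a x + pd 1 b x + pd 2 c x = 0) (k : Fin 2) :
    ∀ᵐ x, (pd k.castSucc b x : ℂ) = 1 * horizRiesz k 0 (fun y => pd 0 b y - pd 1 a y) x
      + (-1) * horizRiesz k 1 (pd 2 c) x := by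
  have hw : MemLp (fun y => pd 0 b y - pd 1 a y) 2 volume := (hb.one 0).sub (ha.one 1)
  refine ae_eq_horizRiesz_add (hb.one k.castSucc) (hc.one 2) hw _ _ _ _ _ _ ?_
  rw [ft_sub (hb.one 0) (ha.one 1)]
  filter_upwards [Lp.coeFn_sub (ft (hb.one 0)) (ft (ha.one 1)), ft_div_eq ha hb hc hdiv,
    ft_pd ha 0, ft_pd ha 1, ft_pd hb k.castSucc, ft_pd hb 0, ft_pd hb 1, ae_horizontal_ne_zero]
    -- Here the underlying identity is `Δ_h b = ∂₀ω - ∂₁∂₂c`.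
    with ξ h1 h4 a0 a1 ak b0 b1 hξ
  rw [h1, Pi.sub_apply, h4, a0, a1, ak, b0, b1]
  have hξ' : ((ξ 0 : ℂ) ^ 2 + (ξ 1 : ℂ) ^ 2) ≠ 0 := by
    simpa using Complex.ofReal_ne_zero.2 hξ
  simp only [horizSymbol, Fin.castSucc_zero, Fin.castSucc_one]
  push_cast
  field_simp
  ring

/-! ### Calculus of integrals controlled by a majorant -/

/-- `F` is integrable and its integral is bounded by `c` times the integral of `M`. -/
structure Controlled (M F : R3 → ℝ) (c : ℝ) : Prop where
  integrable : Integrable F volume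
  bound : |∫ x, F x| ≤ c * ∫ x, M x

namespace Controlled

variable {M F G : R3 → ℝ} {c d : ℝ}

theorem add (hF : Controlled M F c) (hG : Controlled M G d) :
    Controlled M (fun x => F x + G x) (c + d) where
  integrable := hF.integrable.add hG.integrable
  bound := by
    rw [integral_add hF.integrable hG.integrable, add_mul]
    exact (abs_add_le _ _).trans (add_le_add hF.bound hG.bound)

theorem const_mul (hF : Controlled M F c) (a : ℝ) :
    Controlled M (fun x => a * F x) (|a| * c) where
  integrable := hF.integrable.const_mul a
  bound := by
    rw [integral_const_mul, abs_mul, mul_assoc]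
    exact mul_le_mul_of_nonneg_left hF.bound (abs_nonneg a)

theorem neg (hF : Controlled M F c) : Controlled M (fun x => -F x) c where
  integrable := hF.integrable.neg
  bound := by
    rw [integral_neg, abs_neg]
    exact hF.bound

theorem sub (hF : Controlled M F c) (hG : Controlled M G d) :
    Controlled M (fun x => F x - G x) (c + d) := by
  simpa only [sub_eq_add_neg] using hF.add hG.neg

theorem congr (hF : Controlled M F c) (h : ∀ᵐ x, F x = G x) : Controlled M G c where
  integrable := hF.integrable.congr h
  bound := by
    rw [← integral_congr_ae h]
    exact hF.bound

theorem congr_const (hF : Controlled M F c) (h : c = d) : Controlled M F d := h ▸ hF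

theorem sum {ι : Type*} (s : Finset ι) {F : ι → R3 → ℝ} {c : ι → ℝ}
    (h : ∀ i ∈ s, Controlled M (F i) (c i)) :
    Controlled M (fun x => ∑ i ∈ s, F i x) (∑ i ∈ s, c i) where
  integrable := integrable_finsetSum _ fun i hi => (h i hi).integrable
  bound := by
    rw [integral_finsetSum _ fun i hi => (h i hi).integrable, Finset.sum_mul]
    exact (Finset.abs_sum_le_sum_abs _ _).trans (Finset.sum_le_sum fun i hi => (h i hi).bound)

theorem of_integral_eq_zero (hF : Integrable F volume) (h : ∫ x, F x = 0) :
    Controlled M F 0 :=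
  ⟨hF, by simp [h]⟩

theorem of_abs_le (hM : Integrable M volume) (hF : Integrable F volume)
    (h : ∀ x, |F x| ≤ M x) : Controlled M F 1 where
  integrable := hF
  bound := by
    rw [one_mul]
    exact (abs_integral_le_integral_abs).trans (integral_mono hF.abs hM h)

/-- Removing a derivative from one factor of a triple product. -/
theorem pd_mul_mul {f g h : R3 → ℝ} (hM : Integrable M volume) (hf : SmoothH2 f) (hg : SmoothH1 g)
    (hh : SmoothH1 h) (m : Fin 3) (h₁ : ∀ x, |f x * pd m g x * h x| ≤ M x)
    (h₂ : ∀ x, |f x * g x * pd m h x| ≤ M x) :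
    Controlled M (fun x => pd m f x * g x * h x) 2 := by
  have i₀ := integrable_pd_mul_mul hf.toSmoothH1 hg hh m
  have i₁ := integrable_mul_pd_mul hf.toSmoothH1 hf.exists_bound hg hh m
  have i₂ := integrable_mul_mul_pd hf.toSmoothH1 hf.exists_bound hg hh m
  have h₀ := of_integral_eq_zero (M := M) ((i₀.add i₁).add i₂)
    (integral_pd_triple hf.toSmoothH1 hf.exists_bound hg hh m)
  have := (h₀.sub (of_abs_le hM i₁ h₁)).sub (of_abs_le hM i₂ h₂)
  exact (this.congr_const (by norm_num : (0 : ℝ) + 1 + 1 = 2)).congr (Eventually.of_forall fun x => by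
    simp only [Pi.add_apply]
    ring)

end Controlled

/-! ### Pointwise sizes, their integrability, and the majorant -/

theorem abs_pd_le_absGrad (v : R3 → R3) (i j : Fin 3) (x : R3) :
    |pd i (comp v j) x| ≤ absGrad v x := by
  refine Real.abs_le_sqrt ?_
  refine (Finset.single_le_sum (f := fun i => (pd i (comp v j) x) ^ 2)
    (fun i _ => sq_nonneg _) (Finset.mem_univ i)).trans ?_
  exact Finset.single_le_sum (f := fun j => ∑ i : Fin 3, (pd i (comp v j) x) ^ 2)
    (fun j _ => Finset.sum_nonneg fun i _ => sq_nonneg _) (Finset.mem_univ j)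

theorem abs_pd_le_absGradH (v : R3 → R3) {i : Fin 3} (hi : i ≠ 2) (j : Fin 3) (x : R3) :
    |pd i (comp v j) x| ≤ absGradH v x := by
  refine Real.abs_le_sqrt ?_
  refine le_trans ?_ (Finset.single_le_sum
    (f := fun j => (pd 0 (comp v j) x) ^ 2 + (pd 1 (comp v j) x) ^ 2)
    (fun j _ => by positivity) (Finset.mem_univ j))
  have : i = 0 ∨ i = 1 := by omega
  rcases this with rfl | rfl
  · exact le_add_of_nonneg_right (sq_nonneg _)
  · exact le_add_of_nonneg_left (sq_nonneg _)

/-- `absGradGradH` lists only the derivatives whose inner index is horizontal; symmetry of second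
derivatives covers a horizontal outer index. -/
theorem abs_pd_pd_le_absGradGradH {v : R3 → R3} {j : Fin 3} (hv : ContDiff ℝ ∞ (comp v j))
    {i k : Fin 3} (hik : i ≠ 2 ∨ k ≠ 2) (x : R3) :
    |pd i (pd k (comp v j)) x| ≤ absGradGradH v x := by
  have key : ∀ i k : Fin 3, k ≠ 2 → |pd i (pd k (comp v j)) x| ≤ absGradGradH v x := by
    intro i k hk
    refine Real.abs_le_sqrt ?_
    refine le_trans ?_ (Finset.single_le_sum
      (f := fun j => ∑ i : Fin 3,
        ((pd i (pd 0 (comp v j)) x) ^ 2 + (pd i (pd 1 (comp v j)) x) ^ 2))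
      (fun j _ => Finset.sum_nonneg fun i _ => by positivity) (Finset.mem_univ j))
    refine le_trans ?_ (Finset.single_le_sum
      (f := fun i => ((pd i (pd 0 (comp v j)) x) ^ 2 + (pd i (pd 1 (comp v j)) x) ^ 2))
      (fun i _ => by positivity) (Finset.mem_univ i))
    have : k = 0 ∨ k = 1 := by omega
    rcases this with rfl | rfl
    · exact le_add_of_nonneg_right (sq_nonneg _)
    · exact le_add_of_nonneg_left (sq_nonneg _)
  rcases hik with hi | hk
  · rw [pd_comm hv]
    exact key k i hi
  · exact key i k hk

theorem norm_horizRiesz_le_absHorizRiesz (i j : Fin 2) (f : R3 → ℝ) (x : R3) :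
    ‖horizRiesz i j f x‖ ≤ absHorizRiesz f x := by
  refine Real.le_sqrt_of_sq_le ?_
  refine (Finset.single_le_sum (f := fun j => ‖horizRiesz i j f x‖ ^ 2)
    (fun i _ => sq_nonneg _) (Finset.mem_univ j)).trans ?_
  exact Finset.single_le_sum (f := fun i => ∑ j : Fin 2, ‖horizRiesz i j f x‖ ^ 2)
    (fun j _ => Finset.sum_nonneg fun i _ => sq_nonneg _) (Finset.mem_univ i)

theorem memLp_sqrt_add {f g : R3 → ℝ} {p : ENNReal} (hf0 : ∀ x, 0 ≤ f x) (hg0 : ∀ x, 0 ≤ g x)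
    (hf : MemLp (fun x => √(f x)) p volume) (hg : MemLp (fun x => √(g x)) p volume) :
    MemLp (fun x => √(f x + g x)) p volume := by
  -- Measurability is available only for the square roots, so `f` and `g` are recovered as their
  -- squares.
  have e : (fun x => √(f x + g x)) = fun x => √(√(f x) ^ 2 + √(g x) ^ 2) := by
    funext x
    rw [Real.sq_sqrt (hf0 x), Real.sq_sqrt (hg0 x)]
  refine (hf.add hg).of_le ?_ (Eventually.of_forall fun x => ?_)
  · rw [e]
    exact Real.continuous_sqrt.comp_aestronglyMeasurable
      ((hf.aestronglyMeasurable.pow 2).add (hg.aestronglyMeasurable.pow 2))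
  · rw [Real.norm_of_nonneg (Real.sqrt_nonneg _)]
    refine le_trans ?_ (Real.le_norm_self _)
    refine Real.sqrt_le_iff.2 ⟨add_nonneg (Real.sqrt_nonneg _) (Real.sqrt_nonneg _), ?_⟩
    rw [Pi.add_apply, add_sq, Real.sq_sqrt (hf0 x), Real.sq_sqrt (hg0 x)]
    linarith [mul_nonneg (Real.sqrt_nonneg (f x)) (Real.sqrt_nonneg (g x))]

theorem memLp_sqrt_sum {ι : Type*} (s : Finset ι) {f : ι → R3 → ℝ} {p : ENNReal}
    (h0 : ∀ i x, 0 ≤ f i x) (hf : ∀ i, MemLp (fun x => √(f i x)) p volume) :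
    MemLp (fun x => √(∑ i ∈ s, f i x)) p volume := by
  classical
  induction s using Finset.induction_on with
  | empty => simp
  | insert a s ha ih =>
    simp only [Finset.sum_insert ha]
    exact memLp_sqrt_add (h0 a) (fun x => Finset.sum_nonneg fun i _ => h0 i x) (hf a) ih

theorem memLp_sqrt_sq {f : R3 → ℝ} {p : ENNReal} (hf : MemLp f p volume) :
    MemLp (fun x => √(f x ^ 2)) p volume := by
  simpa only [Real.sqrt_sq_eq_abs] using! hf.norm

section Majorant

variable {u b : R3 → R3}

theorem memLp_absGrad (hu : ∀ j, SmoothH2 (comp u j)) : MemLp (absGrad u) 2 volume :=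
  memLp_sqrt_sum _ (fun _ _ => Finset.sum_nonneg fun _ _ => sq_nonneg _) fun j =>
    memLp_sqrt_sum _ (fun _ _ => sq_nonneg _) fun i => memLp_sqrt_sq ((hu j).one i)

theorem memLp_absGradGradH (hu : ∀ j, SmoothH2 (comp u j)) : MemLp (absGradGradH u) 2 volume :=
  memLp_sqrt_sum _ (fun j x => Finset.sum_nonneg fun i _ => by positivity) fun j =>
    memLp_sqrt_sum _ (fun i x => by positivity) fun i =>
      memLp_sqrt_add (fun x => sq_nonneg _) (fun x => sq_nonneg _)
        (memLp_sqrt_sq ((hu j).two i 0)) (memLp_sqrt_sq ((hu j).two i 1))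

theorem memLp_absGradH (hu : ∀ j, SmoothH2 (comp u j)) : MemLp (absGradH u) 2 volume :=
  memLp_sqrt_sum _ (fun j x => by positivity) fun j =>
    memLp_sqrt_add (fun x => sq_nonneg _) (fun x => sq_nonneg _)
      (memLp_sqrt_sq ((hu j).one 0)) (memLp_sqrt_sq ((hu j).one 1))

theorem memLp_absGradH_four (hu : ∀ j, SmoothH2 (comp u j)) : MemLp (absGradH u) 4 volume :=
  memLp_sqrt_sum _ (fun j x => by positivity) fun j =>
    memLp_sqrt_add (fun x => sq_nonneg _) (fun x => sq_nonneg _)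
      (memLp_sqrt_sq ((hu j).deriv 0).memLp_four) (memLp_sqrt_sq ((hu j).deriv 1).memLp_four)

theorem memLp_absHorizRiesz {f : R3 → ℝ} (hf : MemLp f 2 volume) :
    MemLp (absHorizRiesz f) 2 volume :=
  memLp_sqrt_sum _ (fun _ _ => Finset.sum_nonneg fun _ _ => sq_nonneg _) fun i =>
    memLp_sqrt_sum _ (fun _ _ => sq_nonneg _) fun j => memLp_sqrt_sq (memLp_horizRiesz i j hf).norm

theorem SmoothH2.exists_bound_absHorizRiesz {f : R3 → ℝ} (hf : SmoothH2 f) :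
    ∃ C, ∀ᵐ x, ‖absHorizRiesz f x‖ ≤ C := by
  choose C hC using fun i j => hf.exists_bound_horizRiesz i j
  refine ⟨√(∑ i, ∑ j, C i j ^ 2), ?_⟩
  filter_upwards [ae_all_iff.2 fun i => ae_all_iff.2 fun j => hC i j] with x hx
  rw [absHorizRiesz, Real.norm_of_nonneg (Real.sqrt_nonneg _)]
  refine Real.sqrt_le_sqrt (Finset.sum_le_sum fun i _ => Finset.sum_le_sum fun j _ => ?_)
  exact pow_le_pow_left₀ (norm_nonneg _) (hx i j) 2

theorem absGrad_nonneg (v : R3 → R3) (x : R3) : 0 ≤ absGrad v x := Real.sqrt_nonneg _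

theorem absGradH_nonneg (v : R3 → R3) (x : R3) : 0 ≤ absGradH v x := Real.sqrt_nonneg _

theorem absGradGradH_nonneg (v : R3 → R3) (x : R3) : 0 ≤ absGradGradH v x := Real.sqrt_nonneg _

theorem absHorizRiesz_nonneg (f : R3 → ℝ) (x : R3) : 0 ≤ absHorizRiesz f x := Real.sqrt_nonneg _

theorem memLp_curl3 (hu : ∀ j, SmoothH2 (comp u j)) : MemLp (curl3 u) 2 volume :=
  ((hu 1).one 0).sub ((hu 0).one 1)

/-- The Hölder exponents are `L^∞·L²·L²` for the terms with `u₃`, `b₃` and the Riesz transform of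
`u₃`, and `L⁴·L⁴·L²` for the term with `ω₃`, whose Riesz transforms are placed in `L²`. -/
theorem integrable_majorant (hu : ∀ j, SmoothH2 (comp u j)) (hb : ∀ j, SmoothH2 (comp b j)) :
    Integrable (majorant u b) volume := by
  have key : ∀ {w : R3 → R3} (_ : ∀ j, SmoothH2 (comp w j)) {g h g' h' : R3 → ℝ},
      MemLp g 2 volume → MemLp h 2 volume → MemLp g' 2 volume → MemLp h' 2 volume →
      Integrable (fun x => |w x 2| * (g x * h x + g' x * h' x)) volume := by
    intro w hw g h g' h' hg hh hg' hh'
    refine integrable_bdd_mul (hw 2).smooth.continuous.abs ?_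
      ((integrable_mul_of_memLp_two hg hh).add (integrable_mul_of_memLp_two hg' hh'))
    obtain ⟨C, hC⟩ := (hw 2).exists_bound
    exact ⟨C, fun x => by rw [abs_abs]; exact hC x⟩
  refine (((key hu (memLp_absGrad hu) (memLp_absGradGradH hu) (memLp_absGrad hb)
    (memLp_absGradGradH hb)).add (key hb (memLp_absGrad hu) (memLp_absGradGradH hb)
    (memLp_absGrad hb) (memLp_absGradGradH hu))).add ?_).add ?_
  · have h4 := memLp_absGradH_four hb
    have : ENNReal.HolderTriple 4 4 2 := ⟨by
      rw [← ENNReal.toReal_eq_toReal_iff' (by simp) (by simp),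
        ENNReal.toReal_add (by simp) (by simp)]
      norm_num⟩
    have h2 : MemLp (fun x => absGradH b x * absGradH b x) 2 volume := h4.mul' h4
    simpa only [sq] using integrable_mul_of_memLp_two h2 (memLp_absHorizRiesz (memLp_curl3 hu))
  · obtain ⟨C, hC⟩ := (hu 2).exists_bound_absHorizRiesz
    have := (integrable_mul_of_memLp_two (memLp_absGradGradH hb) (memLp_absGradH hb)).bdd_mul
      (memLp_absHorizRiesz (hu 2).zero).aestronglyMeasurable hC
    simpa only [mul_assoc] using this

theorem majorant_le (u b : R3 → R3) (x : R3) :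
    |u x 2| * (absGrad u x * absGradGradH u x) ≤ majorant u b x ∧
    |u x 2| * (absGrad b x * absGradGradH b x) ≤ majorant u b x ∧
    |b x 2| * (absGrad u x * absGradGradH b x) ≤ majorant u b x ∧
    |b x 2| * (absGrad b x * absGradGradH u x) ≤ majorant u b x ∧
    absGradH b x ^ 2 * absHorizRiesz (curl3 u) x ≤ majorant u b x ∧
    absHorizRiesz (comp u 2) x * absGradGradH b x * absGradH b x ≤ majorant u b x := by
  have h1 : 0 ≤ |u x 2| * (absGrad u x * absGradGradH u x) :=
    mul_nonneg (abs_nonneg _) (mul_nonneg (absGrad_nonneg _ _) (absGradGradH_nonneg _ _))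
  have h2 : 0 ≤ |u x 2| * (absGrad b x * absGradGradH b x) :=
    mul_nonneg (abs_nonneg _) (mul_nonneg (absGrad_nonneg _ _) (absGradGradH_nonneg _ _))
  have h3 : 0 ≤ |b x 2| * (absGrad u x * absGradGradH b x) :=
    mul_nonneg (abs_nonneg _) (mul_nonneg (absGrad_nonneg _ _) (absGradGradH_nonneg _ _))
  have h4 : 0 ≤ |b x 2| * (absGrad b x * absGradGradH u x) :=
    mul_nonneg (abs_nonneg _) (mul_nonneg (absGrad_nonneg _ _) (absGradGradH_nonneg _ _))
  have h5 : 0 ≤ absGradH b x ^ 2 * absHorizRiesz (curl3 u) x :=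
    mul_nonneg (sq_nonneg _) (absHorizRiesz_nonneg _ _)
  have h6 : 0 ≤ absHorizRiesz (comp u 2) x * absGradGradH b x * absGradH b x :=
    mul_nonneg (mul_nonneg (absHorizRiesz_nonneg _ _) (absGradGradH_nonneg _ _))
      (absGradH_nonneg _ _)
  unfold majorant
  rw [mul_add, mul_add]
  refine ⟨?_, ?_, ?_, ?_, ?_, ?_⟩ <;> linarith

/-! ### Estimates for the individual cubic products -/

/-- A triple product of first derivatives, one factor of which is a derivative of a vertical
component, is controlled as soon as enough of the derivatives are horizontal. -/
theorem controlled_of_vertical {M : R3 → ℝ} {w v v' : R3 → R3} (hM : Integrable M volume)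
    (hw : ∀ j, SmoothH2 (comp w j)) (hv : ∀ j, SmoothH2 (comp v j))
    (hv' : ∀ j, SmoothH2 (comp v' j))
    (h₁ : ∀ x, |w x 2| * (absGrad v x * absGradGradH v' x) ≤ M x)
    (h₂ : ∀ x, |w x 2| * (absGrad v' x * absGradGradH v x) ≤ M x)
    {m i k : Fin 3} (hi : m ≠ 2 ∨ i ≠ 2) (hk : m ≠ 2 ∨ k ≠ 2) (j l : Fin 3) :
    Controlled M (fun x => pd m (comp w 2) x * pd i (comp v j) x * pd k (comp v' l) x) 2 := by
  refine Controlled.pd_mul_mul hM (hw 2) ((hv j).deriv i) ((hv' l).deriv k) m (fun x => ?_)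
    (fun x => ?_)
  · refine le_trans ?_ (h₂ x)
    rw [abs_mul, abs_mul, mul_assoc, mul_comm |pd m _ x|]
    refine mul_le_mul_of_nonneg_left ?_ (abs_nonneg _)
    exact mul_le_mul (abs_pd_le_absGrad v' k l x) (abs_pd_pd_le_absGradGradH (hv j).smooth hi x)
      (abs_nonneg _) (absGrad_nonneg _ _)
  · refine le_trans ?_ (h₁ x)
    rw [abs_mul, abs_mul, mul_assoc]
    refine mul_le_mul_of_nonneg_left ?_ (abs_nonneg _)
    exact mul_le_mul (abs_pd_le_absGrad v i j x) (abs_pd_pd_le_absGradGradH (hv' l).smooth hk x)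
      (abs_nonneg _) (absGrad_nonneg _ _)

theorem integrable_re_horizRiesz_mul {f q : R3 → ℝ} (hf : MemLp f 2 volume)
    (hq : MemLp q 2 volume) (i j : Fin 2) :
    Integrable (fun x => (horizRiesz i j f x).re * q x) volume :=
  integrable_mul_of_memLp_two (memLp_horizRiesz i j hf).re hq

theorem controlled_horizRiesz_curl3 (hu : ∀ j, SmoothH2 (comp u j)) (hb : ∀ j, SmoothH2 (comp b j))
    {i k : Fin 3} (hi : i ≠ 2) (hk : k ≠ 2) (j l : Fin 3) (m n : Fin 2) :
    Controlled (majorant u b) (fun x => (horizRiesz m n (curl3 u) x).re *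
      (pd i (comp b j) x * pd k (comp b l) x)) 1 := by
  refine Controlled.of_abs_le (integrable_majorant hu hb) (integrable_re_horizRiesz_mul
    (memLp_curl3 hu) (((hb j).deriv i).memLp_mul ((hb l).deriv k)) m n) fun x => ?_
  refine le_trans ?_ (majorant_le u b x).2.2.2.2.1
  rw [abs_mul, abs_mul, mul_comm, sq]
  refine mul_le_mul ?_ ((Complex.abs_re_le_norm _).trans
    (norm_horizRiesz_le_absHorizRiesz m n _ x)) (abs_nonneg _)
    (mul_self_nonneg _)
  exact mul_le_mul (abs_pd_le_absGradH b hi j x) (abs_pd_le_absGradH b hk l x) (abs_nonneg _)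
    (absGradH_nonneg _ _)

/-- The majorant contains Riesz transforms of `u₃` but not of `∂₃u₃`, so `∂₃` is moved onto the
quadratic factor. The product rule gives two terms of type `|∇∇_h b||∇_h b|`, hence the constant
`2`. -/
theorem controlled_horizRiesz_pd (hu : ∀ j, SmoothH2 (comp u j)) (hb : ∀ j, SmoothH2 (comp b j))
    {i k : Fin 3} (hi : i ≠ 2) (hk : k ≠ 2) (j l : Fin 3) (m n : Fin 2) :
    Controlled (majorant u b) (fun x => (horizRiesz m n (pd 2 (comp u 2)) x).re *
      (pd i (comp b j) x * pd k (comp b l) x)) 2 := by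
  have hg := (hb j).deriv i
  have hh := (hb l).deriv k
  have hM := integrable_majorant hu hb
  refine ⟨integrable_re_horizRiesz_mul ((hu 2).one 2) (hg.memLp_mul hh) m n, ?_⟩
  have hint := integrable_mul_horizRiesz ((hu 2).one 2) (hg.memLp_mul hh) m n
  -- Riesz transforms are complex valued here; since the other factor is real, taking the real part
  -- commutes with the product and the integral.
  have e : ∫ x, (horizRiesz m n (pd 2 (comp u 2)) x).re *
      (pd i (comp b j) x * pd k (comp b l) x) =
      (∫ x, ((pd i (comp b j) x * pd k (comp b l) x : ℝ) : ℂ) *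
        horizRiesz m n (pd 2 (comp u 2)) x).re := by
    have := integral_re hint
    simp only [RCLike.re_to_complex] at this
    rw [← this]
    refine integral_congr_ae (Eventually.of_forall fun x => ?_)
    simp only [Complex.re_ofReal_mul]
    ring
  rw [e, integral_mul_mul_horizRiesz_pd (hu 2) hg hh]
  refine (Complex.abs_re_le_norm _).trans ?_
  rw [norm_neg, ← integral_const_mul]
  refine norm_integral_le_of_norm_le (hM.const_mul 2) (Eventually.of_forall fun x => ?_)
  rw [norm_mul, Complex.norm_real]
  have h0 := norm_horizRiesz_le_absHorizRiesz m n (comp u 2) x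
  have h1 : ‖pd 2 (pd i (comp b j)) x * pd k (comp b l) x +
      pd i (comp b j) x * pd 2 (pd k (comp b l)) x‖ ≤ 2 * (absGradGradH b x * absGradH b x) := by
    refine (norm_add_le _ _).trans ?_
    rw [norm_mul, norm_mul, two_mul, mul_comm ‖pd i (comp b j) x‖]
    refine add_le_add ?_ ?_
    · exact mul_le_mul (abs_pd_pd_le_absGradGradH (hb j).smooth (Or.inr hi) x)
        (abs_pd_le_absGradH b hk l x) (norm_nonneg _) (absGradGradH_nonneg _ _)
    · exact mul_le_mul (abs_pd_pd_le_absGradGradH (hb l).smooth (Or.inr hk) x)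
        (abs_pd_le_absGradH b hi j x) (norm_nonneg _) (absGradGradH_nonneg _ _)
  have h2 := (majorant_le u b x).2.2.2.2.2
  calc _ ≤ 2 * (absGradGradH b x * absGradH b x) * absHorizRiesz (comp u 2) x :=
        mul_le_mul h1 h0 (norm_nonneg _)
          (mul_nonneg zero_le_two (mul_nonneg (absGradGradH_nonneg _ _) (absGradH_nonneg _ _)))
    _ = 2 * (absHorizRiesz (comp u 2) x * absGradGradH b x * absGradH b x) := by ring
    _ ≤ _ := by linarith

/-- Horizontal derivatives of the horizontal velocity, tested against quadratic expressions in the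
horizontal derivatives of the magnetic field. -/
theorem controlled_horizontal (hu : ∀ j, SmoothH2 (comp u j)) (hb : ∀ j, SmoothH2 (comp b j))
    (hdiv : ∀ x, divergence u x = 0) {i k : Fin 3} (hi : i ≠ 2) (hk : k ≠ 2) (j l : Fin 3)
    (m n : Fin 2) :
    Controlled (majorant u b) (fun x => pd m.castSucc (comp u n.castSucc) x *
      (pd i (comp b j) x * pd k (comp b l) x)) 3 := by
  have hdiv' : ∀ x, pd 0 (comp u 0) x + pd 1 (comp u 1) x + pd 2 (comp u 2) x = 0 := fun x => by
    have := hdiv x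
    rwa [divergence, Fin.sum_univ_three] at this
  obtain ⟨m₁, m₂, s, hs, hae⟩ : ∃ (m₁ m₂ : Fin 2) (s : ℝ), |s| = 1 ∧
      ∀ᵐ x, (pd m.castSucc (comp u n.castSucc) x : ℂ) = s * horizRiesz m m₁ (curl3 u) x
        + (-1) * horizRiesz m m₂ (pd 2 (comp u 2)) x := by
    have hn : n = 0 ∨ n = 1 := by omega
    rcases hn with rfl | rfl
    · refine ⟨1, 0, -1, by simp, ?_⟩
      simpa using! pd_fst_eq_horizRiesz (hu 0).toSmoothH1 (hu 1).toSmoothH1 (hu 2).toSmoothH1 hdiv' m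
    · refine ⟨0, 1, 1, by simp, ?_⟩
      simpa using! pd_snd_eq_horizRiesz (hu 0).toSmoothH1 (hu 1).toSmoothH1 (hu 2).toSmoothH1 hdiv' m
  have h := ((controlled_horizRiesz_curl3 hu hb hi hk j l m m₁).const_mul s).add
    (controlled_horizRiesz_pd hu hb hi hk j l m m₂).neg
  refine (h.congr_const (by rw [hs]; norm_num)).congr ?_
  filter_upwards [hae] with x hx
  have hx' := congrArg Complex.re hx
  simp at hx'
  rw [hx']
  ring

end Majorant

/-! ### Reduction of the nonlinear terms to cubic terms, and their algebra -/

section Energy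

variable {u b : R3 → R3}

theorem controlled_pd_triple (M : R3 → ℝ) {a v w : R3 → R3} (ha : ∀ j, SmoothH2 (comp a j))
    (hv : ∀ j, SmoothH2 (comp v j)) (hw : ∀ j, SmoothH2 (comp w j)) (m i p q j l : Fin 3) :
    Controlled M (fun x => pd m (comp a i) x * pd p (comp v j) x * pd q (comp w l) x +
      comp a i x * pd m (pd p (comp v j)) x * pd q (comp w l) x +
      comp a i x * pd p (comp v j) x * pd m (pd q (comp w l)) x) 0 := by
  have hf := ha i
  have hg := (hv j).deriv p
  have hh := (hw l).deriv q
  exact Controlled.of_integral_eq_zero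
    (((integrable_pd_mul_mul hf.toSmoothH1 hg hh m).add
      (integrable_mul_pd_mul hf.toSmoothH1 hf.exists_bound hg hh m)).add
      (integrable_mul_mul_pd hf.toSmoothH1 hf.exists_bound hg hh m))
    (integral_pd_triple hf.toSmoothH1 hf.exists_bound hg hh m)

/-- The cubic form in first derivatives which remains after integrating the nonlinear terms by
parts. -/
noncomputable def cubicTerm (u b : R3 → R3) (k i j : Fin 3) : R3 → ℝ := fun x =>
  pd k (comp b i) x * pd i (comp b j) x * pd k (comp u j) x
    + pd k (comp b i) x * pd i (comp u j) x * pd k (comp b j) x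
    - pd k (comp u i) x * pd i (comp u j) x * pd k (comp u j) x
    - pd k (comp u i) x * pd i (comp b j) x * pd k (comp b j) x

/-- The contribution to the nonlinear terms of the `k`-th horizontal second derivative of the
`j`-th components. -/
noncomputable def nonlinearPart (u b : R3 → R3) (k j : Fin 3) : R3 → ℝ := fun x =>
  ∑ i, (comp u i x * pd i (comp u j) x * pd k (pd k (comp u j)) x
    - comp b i x * pd i (comp b j) x * pd k (pd k (comp u j)) x
    + comp u i x * pd i (comp b j) x * pd k (pd k (comp b j)) x
    - comp b i x * pd i (comp u j) x * pd k (pd k (comp b j)) x)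

theorem nonlinearTerms_eq_sum (u b : R3 → R3) (x : R3) :
    nonlinearTerms u b x =
      ∑ j, (nonlinearPart u b 0 j x + nonlinearPart u b 1 j x) := by
  unfold nonlinearTerms
  rw [← Finset.sum_sub_distrib, ← Finset.sum_add_distrib, ← Finset.sum_sub_distrib]
  refine Finset.sum_congr rfl fun j _ => ?_
  simp only [nonlinearPart, advect, lapH, comp, Fin.sum_univ_three]
  ring

/-- Integration by parts in the nonlinear terms. -/
theorem controlled_nonlinearPart_sub_cubicTerm (hu : ∀ j, SmoothH2 (comp u j))
    (hb : ∀ j, SmoothH2 (comp b j)) (hdu : ∀ x, divergence u x = 0)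
    (hdb : ∀ x, divergence b x = 0) (M : R3 → ℝ) (k j : Fin 3) :
    Controlled M (fun x => nonlinearPart u b k j x - ∑ i, cubicTerm u b k i j x) 0 := by
  -- The first four divergences are in direction `k` and move `∂ₖ` off the second derivative. The
  -- last three are in direction `i` and remove the transported second derivatives; `1/2` appears
  -- because differentiating a square yields the same term twice.
  have h := Controlled.sum (M := M) Finset.univ fun i _ =>
    (((((controlled_pd_triple M hu hu hu k i i k j j).sub
      (controlled_pd_triple M hb hb hu k i i k j j)).add
      (controlled_pd_triple M hu hb hb k i i k j j)).sub
      (controlled_pd_triple M hb hu hb k i i k j j)).sub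
      (((controlled_pd_triple M hu hu hu i i k k j j).const_mul (1 / 2)).add
        ((controlled_pd_triple M hu hb hb i i k k j j).const_mul (1 / 2)))).add
      (controlled_pd_triple M hb hb hu i i k k j j)
  refine (h.congr_const (by simp)).congr (Eventually.of_forall fun x => ?_)
  have h1 := hdu x
  have h2 := hdb x
  simp only [divergence, Fin.sum_univ_three] at h1 h2
  simp only [nonlinearPart, cubicTerm, Fin.sum_univ_three, pd_comm (hu j).smooth _ k,
    pd_comm (hb j).smooth _ k]
  linear_combination (-(1 / 2) * pd k (comp u j) x ^ 2 - (1 / 2) * pd k (comp b j) x ^ 2) * h1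
    + pd k (comp b j) x * pd k (comp u j) x * h2

theorem controlled_nonlinearTerms_of_cubicTerm (hu : ∀ j, SmoothH2 (comp u j))
    (hb : ∀ j, SmoothH2 (comp b j)) (hdu : ∀ x, divergence u x = 0)
    (hdb : ∀ x, divergence b x = 0) {M : R3 → ℝ} {c : ℝ}
    (h : Controlled M (fun x => ∑ k : Fin 2, ∑ j, ∑ i, cubicTerm u b k.castSucc i j x) c) :
    Controlled M (nonlinearTerms u b) c := by
  have hS := h.add (Controlled.sum (M := M) Finset.univ fun (k : Fin 2) _ =>
    Controlled.sum (M := M) Finset.univ fun j _ =>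
      controlled_nonlinearPart_sub_cubicTerm hu hb hdu hdb M k.castSucc j)
  refine (hS.congr_const (by simp)).congr (Eventually.of_forall fun x => ?_)
  rw [nonlinearTerms_eq_sum]
  simp only [Fin.sum_univ_two, Fin.castSucc_zero, Fin.castSucc_one, Finset.sum_add_distrib,
    Finset.sum_sub_distrib]
  ring

theorem controlled_vertical_velocity (hu : ∀ j, SmoothH2 (comp u j))
    (hb : ∀ j, SmoothH2 (comp b j)) {m i k : Fin 3} (hi : m ≠ 2 ∨ i ≠ 2) (hk : m ≠ 2 ∨ k ≠ 2)
    (j l : Fin 3) :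
    Controlled (majorant u b)
      (fun x => pd m (comp u 2) x * pd i (comp u j) x * pd k (comp u l) x) 2 ∧
    Controlled (majorant u b)
      (fun x => pd m (comp u 2) x * pd i (comp b j) x * pd k (comp b l) x) 2 :=
  ⟨controlled_of_vertical (integrable_majorant hu hb) hu hu hu (fun x => (majorant_le u b x).1)
    (fun x => (majorant_le u b x).1) hi hk j l,
  controlled_of_vertical (integrable_majorant hu hb) hu hb hb (fun x => (majorant_le u b x).2.1)
    (fun x => (majorant_le u b x).2.1) hi hk j l⟩

theorem controlled_vertical_magnetic (hu : ∀ j, SmoothH2 (comp u j))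
    (hb : ∀ j, SmoothH2 (comp b j)) {m i k : Fin 3} (hi : m ≠ 2 ∨ i ≠ 2) (hk : m ≠ 2 ∨ k ≠ 2)
    (j l : Fin 3) :
    Controlled (majorant u b)
      (fun x => pd m (comp b 2) x * pd i (comp u j) x * pd k (comp b l) x) 2 :=
  controlled_of_vertical (integrable_majorant hu hb) hb hu hb
    (fun x => (majorant_le u b x).2.2.1) (fun x => (majorant_le u b x).2.2.2.1) hi hk j l

/-- For `i = 2` the factor to integrate by parts is `∂ₖ` of a vertical component; for `j = 2` and `i
≠ 2` it is `∂ₖ` or `∂ᵢ` of one, again horizontal. Each product has an even number of magnetic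
factors, so a vertical magnetic factor is accompanied by one derivative of `u` and one of `b`, as in
the majorant. -/
theorem controlled_cubicTerm_of_vertical (hu : ∀ j, SmoothH2 (comp u j))
    (hb : ∀ j, SmoothH2 (comp b j)) {k i j : Fin 3} (hk : k ≠ 2) (hij : i = 2 ∨ j = 2) :
    Controlled (majorant u b) (cubicTerm u b k i j) 8 := by
  have key : Controlled (majorant u b) (cubicTerm u b k i j) (2 + 2 + 2 + 2) := by
    by_cases hi : i = 2
    · subst hi
      refine ((Controlled.add ?_ ?_).sub ?_).sub ?_
      · exact (controlled_vertical_magnetic hu hb (m := k) (i := k) (k := 2) (.inl hk) (.inl hk)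
          j j).congr (Eventually.of_forall fun x => by ring)
      · exact controlled_vertical_magnetic hu hb (.inl hk) (.inl hk) j j
      · exact (controlled_vertical_velocity hu hb (.inl hk) (.inl hk) j j).1
      · exact (controlled_vertical_velocity hu hb (.inl hk) (.inl hk) j j).2
    · obtain rfl : j = 2 := hij.resolve_left hi
      refine ((Controlled.add ?_ ?_).sub ?_).sub ?_
      · exact (controlled_vertical_velocity hu hb (m := k) (i := k) (k := i) (.inl hk) (.inl hk)
          i 2).2.congr (Eventually.of_forall fun x => by ring)
      · exact (controlled_vertical_velocity hu hb (m := i) (i := k) (k := k) (.inl hi) (.inl hi)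
          i 2).2.congr (Eventually.of_forall fun x => by ring)
      · exact (controlled_vertical_velocity hu hb (m := k) (i := k) (k := i) (.inl hk) (.inl hk)
          i 2).1.congr (Eventually.of_forall fun x => by ring)
      · exact (controlled_vertical_magnetic hu hb (m := i) (i := k) (k := k) (.inl hi) (.inl hi)
          i 2).congr (Eventually.of_forall fun x => by ring)
  exact key.congr_const (by norm_num)

/-- By the Cayley-Hamilton theorem and incompressibility, the purely horizontal cubic terms reduce
to products with a vertical derivative of a vertical component and to a quadratic form in the
horizontal magnetic gradient. -/
theorem sum_horizontal_cubicTerm (hdu : ∀ x, divergence u x = 0) (hdb : ∀ x, divergence b x = 0)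
    (x : R3) :
    ∑ k : Fin 2, ∑ i : Fin 2, ∑ j : Fin 2,
      cubicTerm u b k.castSucc i.castSucc j.castSucc x =
    (∑ k : Fin 2, ∑ j : Fin 2,
      (pd 2 (comp u 2) x * pd k.castSucc (comp u j.castSucc) x *
          pd k.castSucc (comp u j.castSucc) x
        - pd 2 (comp b 2) x * pd k.castSucc (comp u j.castSucc) x *
          pd k.castSucc (comp b j.castSucc) x))
    - pd 2 (comp u 2) x * pd 0 (comp u 0) x * pd 1 (comp u 1) x
    + pd 2 (comp u 2) x * pd 0 (comp u 1) x * pd 1 (comp u 0) x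
    + pd 2 (comp u 2) x * pd 0 (comp b 0) x * pd 1 (comp b 1) x
    - pd 2 (comp u 2) x * pd 0 (comp b 1) x * pd 1 (comp b 0) x
    + (pd 0 (comp u 0) x * (pd 1 (comp b 0) x * pd 1 (comp b 0) x)
      - pd 0 (comp u 0) x * (pd 0 (comp b 1) x * pd 0 (comp b 1) x))
    - (pd 1 (comp u 1) x * (pd 1 (comp b 0) x * pd 1 (comp b 0) x)
      - pd 1 (comp u 1) x * (pd 0 (comp b 1) x * pd 0 (comp b 1) x))
    + ∑ k : Fin 2,
      (pd k.castSucc (comp u k.rev.castSucc) x * (pd 0 (comp b 0) x * pd 0 (comp b 1) x)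
      - pd k.castSucc (comp u k.rev.castSucc) x * (pd 0 (comp b 0) x * pd 1 (comp b 0) x)
      - pd k.castSucc (comp u k.rev.castSucc) x * (pd 1 (comp b 1) x * pd 0 (comp b 1) x)
      + pd k.castSucc (comp u k.rev.castSucc) x * (pd 1 (comp b 1) x * pd 1 (comp b 0) x)) := by
  have h1 := hdu x
  have h2 := hdb x
  simp only [divergence, Fin.sum_univ_three] at h1 h2
  have h1' : pd 2 (comp u 2) x = - pd 0 (comp u 0) x - pd 1 (comp u 1) x := by linarith
  have h2' : pd 2 (comp b 2) x = - pd 0 (comp b 0) x - pd 1 (comp b 1) x := by linarith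
  have r0 : Fin.rev (0 : Fin 2) = 1 := rfl
  have r1 : Fin.rev (1 : Fin 2) = 0 := rfl
  -- With `A`, `B` the horizontal gradients, the identities are `tr(A²Aᵀ) = tr A (|A|² - det A)` and
  -- `tr(B²Aᵀ) = tr B (A:B) - det B tr A`. The remaining terms are `tr(A(BᵀB - BBᵀ))`, whose second
  -- factor is symmetric and trace free.
  simp only [cubicTerm, Fin.sum_univ_two, r0, r1, Fin.castSucc_zero, Fin.castSucc_one, h1', h2']
  ring

theorem controlled_sum_horizontal_cubicTerm (hu : ∀ j, SmoothH2 (comp u j))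
    (hb : ∀ j, SmoothH2 (comp b j)) (hdu : ∀ x, divergence u x = 0)
    (hdb : ∀ x, divergence b x = 0) :
    Controlled (majorant u b) (fun x => ∑ k : Fin 2, ∑ i : Fin 2, ∑ j : Fin 2,
      cubicTerm u b k.castSucc i.castSucc j.castSucc x) 60 := by
  have hne : ∀ k : Fin 2, k.castSucc ≠ (2 : Fin 3) := by decide
  have h0 : (0 : Fin 3) ≠ 2 := by decide
  have h1 : (1 : Fin 3) ≠ 2 := by decide
  have vu : ∀ {i k : Fin 3} (_ : i ≠ 2) (_ : k ≠ 2) (j l : Fin 3), _ :=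
    fun {i k} hi hk j l => controlled_vertical_velocity hu hb (m := 2) (i := i) (k := k)
      (.inr hi) (.inr hk) j l
  have vb : ∀ {i k : Fin 3} (_ : i ≠ 2) (_ : k ≠ 2) (j l : Fin 3), _ :=
    fun {i k} hi hk j l => controlled_vertical_magnetic hu hb (m := 2) (i := i) (k := k)
      (.inr hi) (.inr hk) j l
  have hz : ∀ {i k : Fin 3} (_ : i ≠ 2) (_ : k ≠ 2) (j l : Fin 3) (m n : Fin 2), _ :=
    fun {i k} hi hk j l m n => controlled_horizontal hu hb hdu (i := i) (k := k) hi hk j l m n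
  -- The constant is `4·(2+2) + 4·2` for the terms with a vertical factor, plus `4·3 + 2·(4·3)` for
  -- the commutator.
  have h := (((((((Controlled.sum Finset.univ fun (k : Fin 2) _ =>
    Controlled.sum Finset.univ fun (j : Fin 2) _ =>
    (vu (hne k) (hne k) j.castSucc j.castSucc).1.sub
      (vb (hne k) (hne k) j.castSucc j.castSucc)).sub
    (vu h0 h1 0 1).1).add (vu h0 h1 1 0).1).add (vu h0 h1 0 1).2).sub (vu h0 h1 1 0).2).add
    ((hz h1 h1 0 0 0 0).sub (hz h0 h0 1 1 0 0))).sub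
    ((hz h1 h1 0 0 1 1).sub (hz h0 h0 1 1 1 1))).add
    (Controlled.sum Finset.univ fun (k : Fin 2) _ => (((hz h0 h0 0 1 k k.rev).sub
      (hz h0 h1 0 0 k k.rev)).sub (hz h1 h0 1 1 k k.rev)).add (hz h1 h1 1 0 k k.rev))
  exact (h.congr_const (by norm_num)).congr (Eventually.of_forall fun x => (sum_horizontal_cubicTerm hdu hdb x).symm)

theorem controlled_sum_cubicTerm (hu : ∀ j, SmoothH2 (comp u j))
    (hb : ∀ j, SmoothH2 (comp b j)) (hdu : ∀ x, divergence u x = 0)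
    (hdb : ∀ x, divergence b x = 0) :
    Controlled (majorant u b) (fun x => ∑ k : Fin 2, ∑ j, ∑ i, cubicTerm u b k.castSucc i j x)
      140 := by
  have hne : ∀ k : Fin 2, k.castSucc ≠ (2 : Fin 3) := by decide
  -- The index pairs with a vertical entry split disjointly into `j = 2` with `i` horizontal and `i
  -- = 2` with `j` arbitrary, so `140 = 60 + 2·(2+3)·8`.
  have h := (controlled_sum_horizontal_cubicTerm hu hb hdu hdb).add
    (Controlled.sum Finset.univ fun (k : Fin 2) _ =>
      (Controlled.sum Finset.univ fun (i : Fin 2) _ =>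
        controlled_cubicTerm_of_vertical hu hb (hne k) (i := i.castSucc) (.inr rfl)).add
      (Controlled.sum Finset.univ fun (j : Fin 3) _ =>
        controlled_cubicTerm_of_vertical hu hb (hne k) (j := j) (.inl rfl)))
  refine (h.congr_const (by norm_num)).congr (Eventually.of_forall fun x => ?_)
  simp only [Fin.sum_univ_two, Fin.sum_univ_three, Fin.castSucc_zero, Fin.castSucc_one]
  ring

end Energy

/-! ### Time slices and conclusion -/

theorem MemH2.smoothH2 {v : R3 → R3} (hv : MemH2 v) (hs : ContDiff ℝ ∞ v) (j : Fin 3) :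
    SmoothH2 (comp v j) :=
  ⟨(EuclideanSpace.proj (𝕜 := ℝ) j).contDiff.comp hs, hv.zero j, fun i => hv.one i j,
    fun i k => hv.two i k j⟩

theorem contDiff_timeSlice {T : ℝ} {v : ℝ → R3 → R3}
    (hv : ContDiffOn ℝ ∞ (fun z : ℝ × R3 => v z.1 z.2) (Set.Ioo 0 T ×ˢ Set.univ))
    {t : ℝ} (ht : t ∈ Set.Ioo 0 T) : ContDiff ℝ ∞ (v t) := by
  have h := hv.comp (s := Set.univ) (f := fun x : R3 => (t, x))
    (contDiff_const.prodMk contDiff_id).contDiffOn fun x _ => ⟨ht, Set.mem_univ x⟩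
  exact contDiffOn_univ.1 h

theorem proposition1p3 :
    ∃ c : ℝ, 0 ≤ c ∧
      ∀ (T : ℝ) (u b : ℝ → R3 → R3) (p : ℝ → R3 → ℝ), IsSmoothMHDSolution T u b p →
        ∀ t ∈ Set.Ioo 0 T, MemH2 (u t) → MemH2 (b t) →
          Integrable (nonlinearTerms (u t) (b t)) volume ∧
          Integrable (majorant (u t) (b t)) volume ∧
          ∫ x, nonlinearTerms (u t) (b t) x ≤ c * ∫ x, majorant (u t) (b t) x := by
  refine ⟨140, by norm_num, fun T u b p hsol t ht hut hbt => ?_⟩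
  have hu := hut.smoothH2 (contDiff_timeSlice hsol.smooth_u ht)
  have hb := hbt.smoothH2 (contDiff_timeSlice hsol.smooth_b ht)
  have hdu := hsol.div_u t ht
  have hdb := hsol.div_b t ht
  have h := controlled_nonlinearTerms_of_cubicTerm hu hb hdu hdb
    (controlled_sum_cubicTerm hu hb hdu hdb)
  exact ⟨h.integrable, integrable_majorant hu hb, (le_abs_self _).trans h.bound⟩
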